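/- Let $n\ge 2$. Let $V$ be the free-field vertex superalgebra over $\mathbb C$ generated by bosonic fields $X_i,Y_i$ and fermionic fields $\psi_i,\chi_i$ ($1\le i\le n$) and fermionic ghosts $b_a,c^a$ ($1\le a\le n-1$), whose only nontrivial operator product expansions between generators are $$X_i(z)Y_j(0)\sim\frac{\delta_{ij}}{z},\qquad \psi_i(z)\chi_j(0)\sim\frac{\delta_{ij}}{z},\qquad b_a(z)c^{b}(0)\sim\frac{\delta_a^b}{z}$$ (and those obtained by exchanging the two fields). Put $(AB)_p(w)=\oint\frac{dz}{2\pi i}(z-w)^{p-1}A(z)B(w)$; products written by juxtaposition are normally ordered products $(AB)_0$, nested to the right: $ABC=(A(BC)_0)_0$. Let $$J_{BRST}=\sum_{a=1}^{n-1}c^a\left(X_aY_a-X_{a+1}Y_{a+1}+\psi_a\chi_a-\psi_{a+1}\chi_{a+1}\right),\qquad Q=\oint\frac{dz}{2\pi i}J_{BRST}(z),$$ and write $A\equiv B$ if $A-B=Q(w)$ for some $w\in V$. Put $\mathcal A_i=-X_iY_i$ and, for every operator $\mathcal O\in V$, $$\hat{\mathcal A}_i\mathcal O=(\mathcal A_i\mathcal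 O)_0,\qquad \mathcal D_i\mathcal O=(\mathcal A_i\mathcal O)_0+(X_i(Y_i\mathcal O)_0)_0,\qquad D_i=\mathcal D_i+\hat{\mathcal A}_i .$$ Define $$U=-\frac1n\sum_{i=1}^nX_iY_i,\quad U_F=-\frac1n\sum_{i=1}^n\psi_i\chi_i,\quad M_i^+=X_i\psi_i,\quad M_i^-=Y_i\chi_i,$$ and, for $I\subseteq\{1,\dots,n\}$, $\hat{\mathcal X}_I=A_1\cdots A_n$ with $A_i=\chi_i$ for $i\in I$ and $A_i=X_i$ for $i\notin I$, and $\hat{\mathcal Y}_I=B_1\cdots B_n$ with $B_i=\psi_i$ for $i\in I$ and $B_i=Y_i$ for $i\notin I$. For $J\subseteq\{1,\dots,n\}\setminus I$ put $\hat{\mathcal X}_{I,J}=\prod_{k\in J}D_k\hat{\mathcal X}_I$ and $\hat{\mathcal Y}_{I,J}=\prod_{k\in J}D_k\hat{\mathcal Y}_I$ (where the $D_k$ are applied in a fixed order). Finally let $\mathcal X_I=\prod_{i\in I}D_i(X_1\cdots X_n)$ and $\mathcal Y_I=\prod_{i\in I}D_i(Y_1\cdots Y_n)$; these are the operators of the bosonic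 VOA, made of the symplectic bosons $X_i,Y_i$ only. (1) For all disjoint $I,J\subseteq\{1,\dots,n\}$ and every $j\in J$, with $f_j$ the number of elements $k\in I$ with $k<j$ (that is, the number of fermions $\chi_k$, respectively $\psi_k$, with $k<j$ occurring in $\hat{\mathcal X}_{I,J\setminus\{j\}}$, respectively $\hat{\mathcal Y}_{I,J\setminus\{j\}}$), $$\hat{\mathcal X}_{I,J}=D_j\hat{\mathcal X}_{I,J\setminus\{j\}}\equiv(U+U_F)\hat{\mathcal X}_{I,J\setminus\{j\}}+(-1)^{f_j}M_j^+\hat{\mathcal X}_{I\cup\{j\},J\setminus\{j\}},$$ $$\hat{\mathcal Y}_{I,J}=D_j\hat{\mathcal Y}_{I,J\setminus\{j\}}\equiv(U+U_F)\hat{\mathcal Y}_{I,J\setminus\{j\}}-(-1)^{f_j}M_j^-\hat{\mathcal Y}_{I\cup\{j\},J\setminus\{j\}}.$$ (2) For every $I\subseteq\{1,\dots,n\}$, each of $\mathcal X_I$ and $\mathcal Y_I$ is $\equiv$ to a linear combination of the identity and iterated normally ordered products of the operators $U$, $U_F$, $M_i^{\pm}$ ($1\le i\le n$), $\hat{\mathcal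 X}_K$, $\hat{\mathcal Y}_K$ ($K\subseteq\{1,\dots,n\}$) and derivatives of such expressions. -/

import Mathlib

/-!
The free-field vertex superalgebra generated by symplectic bosons `X i, Y i`, complex fermions
`psi i, chi i` (`i = 1, …, n`) and ghosts `b a, c a` (`a = 1, …, n - 1`), with
`X i (z) Y j (0) ~ δ / z`, `psi i (z) chi j (0) ~ δ / z`, `b a (z) c a' (0) ~ δ / z`,
realised on its Fock space; its BRST charge; and the operators built from the covariant
derivatives.  Operators (fields) are identified with states as usual.
-/

noncomputable section

namespace BoundaryVOA

/-! ### Generating fields and modes -/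

/-- The bosonic generating fields. -/
inductive EvenGen (n : ℕ) : Type
  | X (i : Fin n)
  | Y (i : Fin n)

/-- The fermionic generating fields: the fermi multiplets and the ghosts. -/
inductive OddGen (n : ℕ) : Type
  | psi (i : Fin n)
  | chi (i : Fin n)
  | b (a : Fin (n - 1))
  | c (a : Fin (n - 1))

/-- A code for bosonic generators, used only to fix a linear order. -/
def EvenGen.code {n : ℕ} : EvenGen n → ℕ ×ₗ ℕ
  | .X i => toLex (0, i.val)
  | .Y i => toLex (1, i.val)

/-- A code for fermionic generators, used only to fix a linear order. -/
def OddGen.code {n : ℕ} : OddGen n → ℕ ×ₗ ℕ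
  | .psi i => toLex (0, i.val)
  | .chi i => toLex (1, i.val)
  | .b a => toLex (2, a.val)
  | .c a => toLex (3, a.val)

theorem EvenGen.code_injective (n : ℕ) : Function.Injective (EvenGen.code (n := n)) := by
  intro s t h
  cases s <;> cases t <;> simp_all [EvenGen.code, Fin.ext_iff]

theorem OddGen.code_injective (n : ℕ) : Function.Injective (OddGen.code (n := n)) := by
  intro s t h
  cases s <;> cases t <;> simp_all [OddGen.code, Fin.ext_iff]

instance EvenGen.linearOrder (n : ℕ) : LinearOrder (EvenGen n) :=
  LinearOrder.lift' EvenGen.code (EvenGen.code_injective n)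

instance OddGen.linearOrder (n : ℕ) : LinearOrder (OddGen n) :=
  LinearOrder.lift' OddGen.code (OddGen.code_injective n)

/-- The pair `(a, m)` labels the creation mode `a_(-m-1)`, i.e. the field `∂ ^ m a / m!`. -/
abbrev EvenMode (n : ℕ) : Type := EvenGen n ×ₗ ℕ

/-- The pair `(a, m)` labels the creation mode `a_(-m-1)`, i.e. the field `∂ ^ m a / m!`. -/
abbrev OddMode (n : ℕ) : Type := OddGen n ×ₗ ℕ

/-- Labels of the basis of the Fock space: occupation numbers of the bosonic creation modes and
the finite set of occupied fermionic creation modes. -/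
abbrev Occ (n : ℕ) : Type := (EvenMode n →₀ ℕ) × Finset (OddMode n)

/-- The Fock space.  The basis vector labelled by `(m, {s₁ < s₂ < ⋯})` is the product of the bosonic
creation modes given by `m` and of the fermionic ones `s₁ s₂ ⋯` (in this order),
applied to the vacuum. -/
abbrev Fock (n : ℕ) : Type := Occ n →₀ ℂ

variable {n : ℕ}

/-- The vacuum vector, i.e. the identity operator. -/
def vac : Fock n := Finsupp.single (0, ∅) 1

/-- Multiplication by a bosonic creation mode. -/
def evenCre (s : EvenMode n) : Fock n →ₗ[ℂ] Fock n :=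
  Finsupp.linearCombination ℂ fun o : Occ n =>
    (Finsupp.single (o.1 + Finsupp.single s 1, o.2) (1 : ℂ) : Fock n)

/-- The derivative with respect to a bosonic creation mode. -/
def evenAnn (s : EvenMode n) : Fock n →ₗ[ℂ] Fock n :=
  Finsupp.linearCombination ℂ fun o : Occ n =>
    (Finsupp.single (o.1 - Finsupp.single s 1, o.2) (o.1 s : ℂ) : Fock n)

/-- The sign for moving the fermionic mode `s` past the modes of `S` that precede it. -/
def oddSign (s : OddMode n) (S : Finset (OddMode n)) : ℂ :=
  (-1) ^ (S.filter (fun t => t < s)).card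

/-- Left multiplication by a fermionic creation mode. -/
def oddCre (s : OddMode n) : Fock n →ₗ[ℂ] Fock n :=
  Finsupp.linearCombination ℂ fun o : Occ n =>
    if s ∈ o.2 then (0 : Fock n) else Finsupp.single (o.1, insert s o.2) (oddSign s o.2)

/-- The left (odd) derivative with respect to a fermionic creation mode. -/
def oddAnn (s : OddMode n) : Fock n →ₗ[ℂ] Fock n :=
  Finsupp.linearCombination ℂ fun o : Occ n =>
    if s ∈ o.2 then Finsupp.single (o.1, o.2.erase s) (oddSign s o.2) else (0 : Fock n)

/-- The mode `a_(k)` of a bosonic generating field `a(z) = ∑ a_(k) z ^ (-k-1)`; the nonnegative modes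
encode `X(z) Y(0) ~ 1 / z` and `Y(z) X(0) ~ -1 / z`. -/
def evenMode (a : EvenGen n) : ℤ → (Fock n →ₗ[ℂ] Fock n)
  | Int.negSucc m => evenCre (toLex (a, m))
  | Int.ofNat m =>
    match a with
    | .X i => evenAnn (toLex (.Y i, m))
    | .Y i => -evenAnn (toLex (.X i, m))

/-- The mode `a_(k)` of a fermionic generating field; the nonnegative modes encode
`psi(z) chi(0) ~ chi(z) psi(0) ~ 1 / z` and `b(z) c(0) ~ c(z) b(0) ~ 1 / z`. -/
def oddMode (a : OddGen n) : ℤ → (Fock n →ₗ[ℂ] Fock n)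
  | Int.negSucc m => oddCre (toLex (a, m))
  | Int.ofNat m =>
    match a with
    | .psi i => oddAnn (toLex (.chi i, m))
    | .chi i => oddAnn (toLex (.psi i, m))
    | .b i => oddAnn (toLex (.c i, m))
    | .c i => oddAnn (toLex (.b i, m))

/-! ### The state-field correspondence -/

/-- A letter is a generating field with a number `m` of (divided) derivatives. -/
abbrev Letter (n : ℕ) : Type := EvenMode n ⊕ OddMode n

/-- The `k`-th mode of the field `∂ ^ m a / m!`, namely `(-1) ^ m * (k choose m) * a_(k-m)`. -/
def letterMode (s : Letter n) (k : ℤ) : Fock n →ₗ[ℂ] Fock n :=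
  match s with
  | .inl p => ((((-1) ^ (ofLex p).2 * Ring.choose k (ofLex p).2 : ℤ)) : ℂ) •
      evenMode (ofLex p).1 (k - (ofLex p).2)
  | .inr p => ((((-1) ^ (ofLex p).2 * Ring.choose k (ofLex p).2 : ℤ)) : ℂ) •
      oddMode (ofLex p).1 (k - (ofLex p).2)

/-- The sign for exchanging the letter `s` with the word `l`. -/
def letterSign (s : Letter n) (l : List (Letter n)) : ℂ :=
  if s.isRight then (-1) ^ (l.filter (fun t => t.isRight)).length else 1

/-- The `k`-th mode of the nested normally ordered product of the letters of a word, through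
`:A F:_(k) = ∑_{j ≥ 0} (A_(-1-j) F_(k+j) + (-1) ^ (|A| |F|) F_(k-1-j) A_(j))`.
On every vector only finitely many terms are nonzero. -/
def wordMode : List (Letter n) → ℤ → Fock n → Fock n
  | [], k, v => if k = -1 then v else 0
  | s :: l, k, v =>
      (∑ᶠ j : ℕ, letterMode s (-1 - j) (wordMode l (k + j) v)) +
        letterSign s l • ∑ᶠ j : ℕ, wordMode l (k - 1 - j) (letterMode s j v)

/-- The creation modes of a basis vector, in the order in which they occur in it. -/
def Occ.word (o : Occ n) : List (Letter n) :=
  ((Finsupp.toMultiset o.1).sort (· ≤ ·)).map Sum.inl ++ (o.2.sort (· ≤ ·)).map Sum.inr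

/-- The mode `u_(k) v` of the field of the state `u`, applied to the state `v`. -/
def mode (u : Fock n) (k : ℤ) (v : Fock n) : Fock n :=
  u.sum fun o z => z • wordMode o.word k v

/-- The product `(A B)_p (w) = ∮ dz / (2 π i) (z - w) ^ (p - 1) A(z) B(w)`. -/
def opProd (p : ℤ) (A B : Fock n) : Fock n := mode A (p - 1) B

/-- The normally ordered product `(A B)_0`. -/
def nop (A B : Fock n) : Fock n := opProd 0 A B

/-- The derivative `∂ A`, as `A_(-2)` applied to the vacuum. -/
def deriv (A : Fock n) : Fock n := mode A (-2) vac

/-! ### Generating operators and the BRST charge -/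

def opX (i : Fin n) : Fock n := evenMode (.X i) (-1) vac
def opY (i : Fin n) : Fock n := evenMode (.Y i) (-1) vac
def opPsi (i : Fin n) : Fock n := oddMode (.psi i) (-1) vac
def opChi (i : Fin n) : Fock n := oddMode (.chi i) (-1) vac
def opC (a : Fin (n - 1)) : Fock n := oddMode (.c a) (-1) vac

/-- The current `X i Y i + psi i chi i`. -/
def current (i : Fin n) : Fock n := nop (opX i) (opY i) + nop (opPsi i) (opChi i)

/-- The BRST current
`∑_{a = 1}^{n - 1} c^a (X_a Y_a - X_{a+1} Y_{a+1} + psi_a chi_a - psi_{a+1} chi_{a+1})`. -/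
def brstCurrent (n : ℕ) : Fock n :=
  ∑ a : Fin (n - 1),
    nop (opC a) (current ⟨a.val, by have := a.isLt; omega⟩ -
      current ⟨a.val + 1, by have := a.isLt; omega⟩)

/-- The BRST charge `∮ dz / (2 π i) J_BRST(z)`. -/
def Q (v : Fock n) : Fock n := mode (brstCurrent n) 0 v

/-- `A ≡ B`: the difference is `Q`-exact. -/
def Equivalent (A B : Fock n) : Prop := ∃ w : Fock n, A - B = Q w

/-! ### Covariant derivatives -/

/-- `𝒜_i = -X_i Y_i`. -/
def calA (i : Fin n) : Fock n := -nop (opX i) (opY i)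

/-- `𝒟_i O = (𝒜_i O)_0 + (X_i (Y_i O)_0)_0`. -/
def partialD (i : Fin n) (v : Fock n) : Fock n :=
  nop (calA i) v + nop (opX i) (nop (opY i) v)

/-- `D_i O = 𝒟_i O + (𝒜_i O)_0`. -/
def covD (i : Fin n) (v : Fock n) : Fock n := partialD i v + nop (calA i) v

/-- `∏_{j ∈ J} D_j`; the operators `D_j` commute, and are applied here in a fixed order. -/
def covDProd (J : Finset (Fin n)) (v : Fock n) : Fock n := (J.sort (· ≤ ·)).foldr covD v

/-! ### The operators of the bosonic and of the boundary vertex algebra -/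

/-- The nested normally ordered product `A_1 A_2 ⋯ A_n`. -/
def nestedProd (A : Fin n → Fock n) : Fock n := (List.finRange n).foldr (fun i v => nop (A i) v) vac

/-- `𝒳_I = ∏_{i ∈ I} D_i (X_1 ⋯ X_n)`. -/
def calX (I : Finset (Fin n)) : Fock n := covDProd I (nestedProd opX)

/-- `𝒴_I = ∏_{i ∈ I} D_i (Y_1 ⋯ Y_n)`. -/
def calY (I : Finset (Fin n)) : Fock n := covDProd I (nestedProd opY)

/-- `U = -(1 / n) ∑ X_i Y_i`. -/
def opU (n : ℕ) : Fock n := -((1 / n : ℂ) • ∑ i : Fin n, nop (opX i) (opY i))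

/-- `U_F = -(1 / n) ∑ psi_i chi_i`. -/
def opUF (n : ℕ) : Fock n := -((1 / n : ℂ) • ∑ i : Fin n, nop (opPsi i) (opChi i))

/-- `M_i^+ = X_i psi_i`. -/
def opMplus (i : Fin n) : Fock n := nop (opX i) (opPsi i)

/-- `M_i^- = Y_i chi_i`. -/
def opMminus (i : Fin n) : Fock n := nop (opY i) (opChi i)

/-- `A_1 ⋯ A_n` with `A_i = chi_i` for `i ∈ I` and `A_i = X_i` otherwise. -/
def hatX (I : Finset (Fin n)) : Fock n := nestedProd fun i => if i ∈ I then opChi i else opX i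

/-- `B_1 ⋯ B_n` with `B_i = psi_i` for `i ∈ I` and `B_i = Y_i` otherwise. -/
def hatY (I : Finset (Fin n)) : Fock n := nestedProd fun i => if i ∈ I then opPsi i else opY i

/-- `∏_{j ∈ J} D_j` applied to `hatX I`. -/
def hatX₂ (I J : Finset (Fin n)) : Fock n := covDProd J (hatX I)

/-- `∏_{j ∈ J} D_j` applied to `hatY I`. -/
def hatY₂ (I J : Finset (Fin n)) : Fock n := covDProd J (hatY I)

/-- The number of fermions `chi_k` (resp. `psi_k`) with `k < j` in `hatX I` (resp. `hatY I`); the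
bosonic operators `D_k` do not change it. -/
def fermionCount (I : Finset (Fin n)) (j : Fin n) : ℕ := (I.filter (fun k => k < j)).card

/-- The generators `U`, `U_F`, `M_i^±`, `hatX I`, `hatY I` of the boundary vertex algebra. -/
def generators (n : ℕ) : Set (Fock n) :=
  {opU n, opUF n} ∪ Set.range opMplus ∪ Set.range opMminus ∪ Set.range hatX ∪ Set.range hatY

/-- Linear combinations of iterated normally ordered products of elements of `G` and of their
derivatives. -/
inductive IsNormallyOrderedPolynomial (G : Set (Fock n)) : Fock n → Prop
  | vac : IsNormallyOrderedPolynomial G vac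
  | mem (A : Fock n) : A ∈ G → IsNormallyOrderedPolynomial G A
  | add (A B : Fock n) : IsNormallyOrderedPolynomial G A → IsNormallyOrderedPolynomial G B →
      IsNormallyOrderedPolynomial G (A + B)
  | smul (z : ℂ) (A : Fock n) : IsNormallyOrderedPolynomial G A →
      IsNormallyOrderedPolynomial G (z • A)
  | deriv (A : Fock n) : IsNormallyOrderedPolynomial G A →
      IsNormallyOrderedPolynomial G (deriv A)
  | nop (A B : Fock n) : IsNormallyOrderedPolynomial G A → IsNormallyOrderedPolynomial G B →
      IsNormallyOrderedPolynomial G (nop A B)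

end BoundaryVOA

end

/-!
Let `J i = X i Y i + psi i chi i`, so that the BRST current is the sum of the
`c a (J a - J (a + 1))`. On a state `v` on which the nonnegative modes of the ghosts `c` vanish and
those of all the currents agree, `Q` sends `b a v` to `J a v - J (a + 1) v`. Hence on such states
the differences of the currents are exact, and every `-J j` may be replaced by the average of the
`-J i` over `i`, which is `U + U_F`.

On the other hand, let `w` have no singular operator product expansion with the generators `X j`,
`Y j`, `psi j`, `chi j`. Then `D j (X j w)` is `-X j X j Y j w + 2 (∂ X j) w`. The current `-J j`
applied to `X j w` yields this with only one derivative term and with an extra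
`-X j psi j chi j w`, and `X j psi j` applied to `chi j w` compensates for both: its derivative term
comes from the contraction of `psi j` with `chi j`. The same happens with `X, chi` and `Y, psi`
exchanged, up to signs, and this is the recursion. Since `U + U_F` and the `M_i^±` preserve the span
of the exact differences of currents, the recursion may be iterated, and it reduces every `X_I` and
`Y_I` to the products `hatX K` and `hatY K`.
-/

noncomputable section

namespace BoundaryVOA

open Filter

/-! ### Fields and normally ordered products -/

section FiniteSums

variable {M : Type*} [AddCommMonoid M]

theorem hasFiniteSupport_of_eventually {f : ℕ → M} (h : ∀ᶠ j in atTop, f j = 0) :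
    f.HasFiniteSupport := by
  rwa [← Nat.cofinite_eq_atTop, eventually_cofinite] at h

theorem finsum_eq_zero_add {f : ℕ → M} (h : ∀ᶠ j in atTop, f j = 0) :
    ∑ᶠ j, f j = f 0 + ∑ᶠ j, f (j + 1) := by
  obtain ⟨N, hN⟩ := eventually_atTop.1 h
  have support_le (m : ℕ) (g : ℕ → M) (hg : ∀ j ≥ m, g j = 0) :
      Function.support g ⊆ Finset.range m := fun j hj => by
    by_contra h'
    exact hj (hg j (by simpa using h'))
  rw [finsum_eq_sum_of_support_subset _ (support_le (N + 1) f fun j hj => hN j (by omega)),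
    finsum_eq_sum_of_support_subset _ (support_le N _ fun j hj => hN (j + 1) (by omega)),
    Finset.sum_range_succ', add_comm]

theorem finsum_comm_of_eventually {F : ℕ → ℕ → M} (h₁ : ∀ᶠ i in atTop, ∀ j, F i j = 0)
    (h₂ : ∀ i, ∀ᶠ j in atTop, F i j = 0) : ∑ᶠ i, ∑ᶠ j, F i j = ∑ᶠ j, ∑ᶠ i, F i j := by
  obtain ⟨N, hN⟩ := eventually_atTop.1 h₁
  have hfin : (Function.support fun p : ℕ × ℕ => F p.1 p.2).Finite := by
    refine ((Set.finite_Iio N).biUnion fun i _ =>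
      (hasFiniteSupport_of_eventually (h₂ i)).image (Prod.mk i)).subset fun p hp => ?_
    refine Set.mem_biUnion (lt_of_not_ge fun hi => hp (hN p.1 hi p.2)) ⟨p.2, hp, rfl⟩
  have hfin' : (Function.support fun p : ℕ × ℕ => F p.2 p.1).Finite :=
    hfin.preimage (Equiv.prodComm ℕ ℕ).injective.injOn
  rw [← finsum_curry _ hfin, ← finsum_curry _ hfin', ← finsum_comp_equiv (Equiv.prodComm ℕ ℕ)]
  rfl

end FiniteSums

section Fields

variable {R V : Type*} [CommRing R] [AddCommGroup V] [Module R V]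

/-- The sum of a sequence of operators only finitely many of which are nonzero on each vector. -/
def pointwiseSum (f : ℕ → Module.End R V) (hf : ∀ v, ∀ᶠ j in atTop, f j v = 0) :
    Module.End R V where
  toFun v := ∑ᶠ j, f j v
  map_add' v w := by
    simp only [map_add]
    exact finsum_add_distrib (hasFiniteSupport_of_eventually (hf v))
      (hasFiniteSupport_of_eventually (hf w))
  map_smul' r v := by
    simp only [map_smul]
    exact (smul_finsum' r (hasFiniteSupport_of_eventually (hf v))).symm

variable (R V) in
/-- The fields on `V`, given by their modes `s k`, i.e. `s(z) = ∑ₖ s k z ^ (-k-1)`: on every vector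
the modes of large index vanish. -/
def fields : Submodule R (ℤ → Module.End R V) where
  carrier := {s | ∀ v, ∀ᶠ k in atTop, s k v = 0}
  zero_mem' _ := .of_forall fun _ => rfl
  add_mem' hs ht v := by
    filter_upwards [hs v, ht v] with k hsk htk
    simp [hsk, htk]
  smul_mem' r s hs v := by
    filter_upwards [hs v] with k hsk
    simp [hsk]

instance : CoeFun (fields R V) fun _ => ℤ → Module.End R V := ⟨Subtype.val⟩

-- A shortcut: the generic search for a subtraction fails when `V` consists of finitely supported
-- functions.
instance : AddCommGroup (fields R V) := inferInstance

theorem fields_ext {s t : fields R V} (h : ∀ k v, s k v = t k v) : s = t :=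
  Subtype.ext <| funext fun k => LinearMap.ext (h k)

variable (s t u : fields R V) (k : ℤ) (v : V)

theorem eventually_field_add : ∀ᶠ j : ℕ in atTop, s (k + j) v = 0 :=
  (tendsto_atTop_add_const_left _ k tendsto_natCast_atTop_atTop).eventually (s.2 v)

theorem eventually_field : ∀ᶠ j : ℕ in atTop, s j v = 0 := by
  simpa using eventually_field_add s 0 v

theorem eventually_creMul : ∀ᶠ j : ℕ in atTop, s (-1 - j) (t (k + j) v) = 0 := by
  filter_upwards [eventually_field_add t k v] with j hj
  rw [hj, map_zero]

theorem eventually_annMul : ∀ᶠ j : ℕ in atTop, t (k - 1 - j) (s j v) = 0 := by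
  filter_upwards [eventually_field s v] with j hj
  rw [hj, map_zero]

theorem eventually_forall_field_comp :
    ∀ᶠ k : ℤ in atTop, ∀ j : ℕ, t (k - 1 - j) (s j v) = 0 := by
  obtain ⟨N, hN⟩ := eventually_atTop.1 (eventually_field s v)
  have hfin : ∀ᶠ k : ℤ in atTop, ∀ j ∈ Set.Iio N, t (k - 1 - j) (s j v) = 0 := by
    refine (Set.finite_Iio N).eventually_all.2 fun j _ => ?_
    obtain ⟨M, hM⟩ := eventually_atTop.1 (t.2 (s j v))
    filter_upwards [eventually_ge_atTop (M + 1 + j)] with k hk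
    exact hM _ (by omega)
  filter_upwards [hfin] with k hk j
  rcases lt_or_ge j N with hj | hj
  · exact hk j hj
  · rw [hN j hj, map_zero]

variable (R V) in
/-- The half `∑_{j ≥ 0} s (-1-j) ∘ t (k+j)` of the normally ordered product of two fields, where the
creation modes of `s` act last. -/
def creMul : fields R V →ₗ[R] fields R V →ₗ[R] fields R V :=
  LinearMap.mk₂ R
    (fun s t => ⟨fun k => pointwiseSum (fun j => s (-1 - j) ∘ₗ t (k + j)) (eventually_creMul s t k),
      fun v => by
        obtain ⟨N, hN⟩ := eventually_atTop.1 (t.2 v)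
        filter_upwards [eventually_ge_atTop N] with k hk
        refine finsum_eq_zero_of_forall_eq_zero fun j => ?_
        rw [LinearMap.comp_apply, hN (k + j) (by omega), map_zero]⟩)
    (fun s s' t => fields_ext fun k v =>
      finsum_add_distrib (hasFiniteSupport_of_eventually (eventually_creMul s t k v))
        (hasFiniteSupport_of_eventually (eventually_creMul s' t k v)))
    (fun r s t => fields_ext fun k v =>
      (smul_finsum' r (hasFiniteSupport_of_eventually (eventually_creMul s t k v))).symm)
    (fun s t t' => fields_ext fun k v => (finsum_congr fun j => map_add (s _) _ _).trans <|
      finsum_add_distrib (hasFiniteSupport_of_eventually (eventually_creMul s t k v))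
        (hasFiniteSupport_of_eventually (eventually_creMul s t' k v)))
    (fun r s t => fields_ext fun k v => (finsum_congr fun j => map_smul (s _) _ _).trans <|
      (smul_finsum' r (hasFiniteSupport_of_eventually (eventually_creMul s t k v))).symm)

variable (R V) in
/-- The half `∑_{j ≥ 0} t (k-1-j) ∘ s j` of the normally ordered product of two fields, where the
annihilation modes of `s` act first; the sign for exchanging the fields is left to `nord`. -/
def annMul : fields R V →ₗ[R] fields R V →ₗ[R] fields R V :=
  LinearMap.mk₂ R
    (fun s t => ⟨fun k => pointwiseSum (fun j => t (k - 1 - j) ∘ₗ s j) (eventually_annMul s t k),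
      fun v => by
        filter_upwards [eventually_forall_field_comp s t v] with k hk
        exact finsum_eq_zero_of_forall_eq_zero hk⟩)
    (fun s s' t => fields_ext fun k v => (finsum_congr fun j => map_add (t _) _ _).trans <|
      finsum_add_distrib (hasFiniteSupport_of_eventually (eventually_annMul s t k v))
        (hasFiniteSupport_of_eventually (eventually_annMul s' t k v)))
    (fun r s t => fields_ext fun k v => (finsum_congr fun j => map_smul (t _) _ _).trans <|
      (smul_finsum' r (hasFiniteSupport_of_eventually (eventually_annMul s t k v))).symm)
    (fun s t t' => fields_ext fun k v =>
      finsum_add_distrib (hasFiniteSupport_of_eventually (eventually_annMul s t k v))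
        (hasFiniteSupport_of_eventually (eventually_annMul s t' k v)))
    (fun r s t => fields_ext fun k v =>
      (smul_finsum' r (hasFiniteSupport_of_eventually (eventually_annMul s t k v))).symm)

theorem creMul_apply : creMul R V s t k v = ∑ᶠ j : ℕ, s (-1 - j) (t (k + j) v) := rfl

theorem annMul_apply : annMul R V s t k v = ∑ᶠ j : ℕ, t (k - 1 - j) (s j v) := rfl

/-- The normally ordered product of two fields, `ε` being the sign for exchanging them. -/
def nord (ε : R) : fields R V →ₗ[R] fields R V →ₗ[R] fields R V := creMul R V + ε • annMul R V

theorem nord_eq (ε : R) : nord ε s t = creMul R V s t + ε • annMul R V s t := rfl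

theorem nord_apply (ε : R) :
    nord ε s t k v = creMul R V s t k v + ε • annMul R V s t k v := rfl

theorem map_creMul_apply (A : Module.End R V) :
    A (creMul R V s t k v) = ∑ᶠ j : ℕ, A (s (-1 - j) (t (k + j) v)) :=
  map_finsum A (hasFiniteSupport_of_eventually (eventually_creMul s t k v))

theorem map_annMul_apply (A : Module.End R V) :
    A (annMul R V s t k v) = ∑ᶠ j : ℕ, A (t (k - 1 - j) (s j v)) :=
  map_finsum A (hasFiniteSupport_of_eventually (eventually_annMul s t k v))

section Exchange

variable {s t}

theorem creMul_creMul_comm {η : R}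
    (h : ∀ (i j : ℕ) v, s (-1 - i) (t (-1 - j) v) = η • t (-1 - j) (s (-1 - i) v)) :
    creMul R V s (creMul R V t u) = η • creMul R V t (creMul R V s u) := by
  refine fields_ext fun k v => ?_
  obtain ⟨N, hN⟩ := eventually_atTop.1 (u.2 v)
  have hzero (i j : ℕ) (hij : (N - k).toNat ≤ i + j) :
      s (-1 - i) (t (-1 - j) (u (k + i + j) v)) = 0 := by
    rw [hN _ (by omega), map_zero, map_zero]
  calc creMul R V s (creMul R V t u) k v
      = ∑ᶠ (i : ℕ) (j : ℕ), s (-1 - i) (t (-1 - j) (u (k + i + j) v)) := by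
        simp only [creMul_apply s, map_creMul_apply]
    _ = ∑ᶠ (j : ℕ) (i : ℕ), s (-1 - i) (t (-1 - j) (u (k + i + j) v)) :=
        finsum_comm_of_eventually
          ((eventually_ge_atTop (N - k).toNat).mono fun i hi j => hzero i j (by omega))
          fun i => (eventually_ge_atTop (N - k).toNat).mono fun j hj => hzero i j (by omega)
    _ = ∑ᶠ (j : ℕ) (i : ℕ), t (-1 - j) (s (-1 - i) ((η • u) (k + j + i) v)) := by
        simp only [h, add_right_comm k, Submodule.coe_smul, Pi.smul_apply, LinearMap.smul_apply,
          map_smul]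
    _ = (η • creMul R V t (creMul R V s u)) k v := by
        simp only [← map_smul, creMul_apply t, map_creMul_apply]

variable (s t) in
theorem creMul_annMul_comm :
    creMul R V s (annMul R V t u) = annMul R V t (creMul R V s u) := by
  refine fields_ext fun k v => ?_
  calc creMul R V s (annMul R V t u) k v
      = ∑ᶠ (i : ℕ) (j : ℕ), s (-1 - i) (u (k + i - 1 - j) (t j v)) := by
        simp only [creMul_apply s, map_annMul_apply]
    _ = ∑ᶠ (j : ℕ) (i : ℕ), s (-1 - i) (u (k + i - 1 - j) (t j v)) :=
        finsum_comm_of_eventually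
          (((tendsto_atTop_add_const_left _ k tendsto_natCast_atTop_atTop).eventually
            (eventually_forall_field_comp t u v)).mono fun i hi j => by rw [hi, map_zero])
          fun i => (eventually_annMul t u (k + i) v).mono fun j hj => by rw [hj, map_zero]
    _ = annMul R V t (creMul R V s u) k v := by
        simp only [annMul_apply t, creMul_apply s, sub_add_eq_add_sub]

theorem annMul_annMul_comm {η : R} (h : ∀ (i j : ℕ) v, t i (s j v) = η • s j (t i v)) :
    annMul R V s (annMul R V t u) = η • annMul R V t (annMul R V s u) := by
  refine fields_ext fun k v => ?_
  calc annMul R V s (annMul R V t u) k v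
      = ∑ᶠ (j : ℕ) (i : ℕ), u (k - 1 - j - 1 - i) (t i (s j v)) := by
        simp only [annMul_apply]
    _ = ∑ᶠ (i : ℕ) (j : ℕ), u (k - 1 - j - 1 - i) (t i (s j v)) :=
        finsum_comm_of_eventually
          ((eventually_field s v).mono fun j hj i => by rw [hj, map_zero, map_zero])
          fun j => (eventually_field t (s j v)).mono fun i hi => by rw [hi, map_zero]
    _ = ∑ᶠ (i : ℕ) (j : ℕ), (η • u) (k - 1 - i - 1 - j) (s j (t i v)) := by
        refine finsum_congr fun i => finsum_congr fun j => ?_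
        rw [h, map_smul, show k - 1 - j - 1 - (i : ℤ) = k - 1 - i - 1 - j by ring]
        rfl
    _ = (η • annMul R V t (annMul R V s u)) k v := by
        simp only [← map_smul, annMul_apply]

theorem nord_nord_comm {η : R} (hη : η * η = 1) (εs εt : R)
    (hcre : ∀ (i j : ℕ) v, s (-1 - i) (t (-1 - j) v) = η • t (-1 - j) (s (-1 - i) v))
    (hann : ∀ (i j : ℕ) v, t i (s j v) = η • s j (t i v)) :
    nord (η * εs) s (nord εt t u) = η • nord (η * εt) t (nord εs s u) := by
  simp only [nord_eq, map_add, map_smul, creMul_creMul_comm u hcre, annMul_annMul_comm u hann,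
    creMul_annMul_comm]
  linear_combination (norm := module) -hη • εt • annMul R V t (creMul R V s u)

end Exchange

variable (R V) in
/-- The identity field `1 = 1 ⋅ z ^ 0`. -/
def idField : fields R V :=
  ⟨fun k => if k = -1 then 1 else 0, fun v => by
    filter_upwards [eventually_ge_atTop 0] with k hk
    rw [if_neg (by omega), LinearMap.zero_apply]⟩

theorem idField_apply : idField R V k v = if k = -1 then v else 0 := by
  by_cases h : k = -1 <;> simp [idField, h]

theorem nord_idField_right : nord 1 s (idField R V) = s := by
  refine fields_ext fun k v => ?_
  simp only [nord_apply, creMul_apply, annMul_apply, idField_apply, apply_ite, map_zero, one_smul]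
  rcases lt_or_ge k 0 with h | h
  · rw [finsum_eq_single _ (-1 - k).toNat fun j hj => if_neg (by omega), if_pos (by omega),
      finsum_eq_zero_of_forall_eq_zero fun j => if_neg (by omega), add_zero,
      show -1 - ((-1 - k).toNat : ℤ) = k by omega]
  · rw [finsum_eq_zero_of_forall_eq_zero fun j => if_neg (by omega),
      finsum_eq_single _ k.toNat fun j hj => if_neg (by omega), if_pos (by omega), zero_add,
      Int.toNat_of_nonneg h]

theorem nord_idField_left (ε : R) : nord ε (idField R V) t = t := by
  refine fields_ext fun k v => ?_
  rw [nord_apply, creMul_apply, annMul_apply,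
    finsum_eq_single _ 0 fun j hj => by rw [idField_apply, if_neg (by omega)],
    finsum_eq_zero_of_forall_eq_zero fun j => by rw [idField_apply, if_neg (by omega), map_zero]]
  simp [idField_apply]

section Annihilated

variable {s t v}

theorem nord_apply_natCast_eq_zero (ε : R) (hs : ∀ j : ℕ, s j v = 0) (ht : ∀ j : ℕ, t j v = 0)
    (p : ℕ) : nord ε s t p v = 0 := by
  have ht' (j : ℕ) : t (p + j) v = 0 := by exact_mod_cast ht (p + j)
  simp [nord_apply, creMul_apply, annMul_apply, hs, ht']

theorem nord_apply_neg_one (ε : R) (hs : ∀ j : ℕ, s j v = 0) (ht : ∀ j : ℕ, t j v = 0) :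
    nord ε s t (-1) v = s (-1) (t (-1) v) := by
  have ht' (j : ℕ) : t (-1 + ((j + 1 : ℕ) : ℤ)) v = 0 := by simpa using ht j
  rw [nord_apply, creMul_apply, annMul_apply, finsum_eq_zero_add (eventually_creMul s t _ v)]
  simp only [ht', hs, map_zero, finsum_zero, smul_zero, add_zero, Nat.cast_zero, sub_zero]

end Annihilated

/-- The field `s` with its modes renumbered, i.e. `z ^ m s(z)`. -/
def shift (m : ℤ) (s : fields R V) : fields R V :=
  ⟨fun k => s (k + m), fun v => (tendsto_atTop_add_const_right _ m tendsto_id).eventually (s.2 v)⟩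

theorem shift_apply (m : ℤ) : shift m s k = s (k + m) := rfl

theorem shift_shift (l m : ℤ) : shift l (shift m s) = shift (l + m) s :=
  fields_ext fun k v => by simp only [shift_apply, add_assoc]

theorem shift_zero : shift 0 s = s := fields_ext fun k v => by rw [shift_apply, add_zero]

theorem creMul_shift_one :
    creMul R V (shift 1 s) t k v = s 0 (t k v) + creMul R V s (shift 1 t) k v := by
  rw [creMul_apply, creMul_apply, finsum_eq_zero_add (eventually_creMul (shift 1 s) t k v)]
  simp [shift_apply, add_assoc, sub_add_eq_sub_sub]

theorem annMul_shift_one :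
    annMul R V s (shift 1 t) k v = t k (s 0 v) + annMul R V (shift 1 s) t k v := by
  rw [annMul_apply, annMul_apply, finsum_eq_zero_add (eventually_annMul s (shift 1 t) k v)]
  simp [shift_apply, sub_add_eq_sub_sub]

theorem nord_shift_one (ε : R) : nord ε (shift 1 s) t k v =
    nord ε s (shift 1 t) k v + (s 0 (t k v) - ε • t k (s 0 v)) := by
  rw [nord_apply, nord_apply, creMul_shift_one, annMul_shift_one, smul_add]
  abel

section SimpleOPE

variable {s t}

/-- The fields `s` and `t` have the operator product expansion `s(z) t(0) ~ c / z`, `ε` being the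
sign for exchanging them. -/
def HasSimpleOPE (ε c : R) (s t : fields R V) : Prop :=
  ∀ (i j : ℤ) (v : V), s i (t j v) = ε • t j (s i v) + (if i + j = -1 then c else 0) • v

theorem HasSimpleOPE.apply_comm {ε c : R} (h : HasSimpleOPE ε c s t) {i j : ℤ}
    (hij : i + j ≠ -1) (v : V) : s i (t j v) = ε • t j (s i v) := by
  rw [h, if_neg hij, zero_smul, add_zero]

theorem hasSimpleOPE_idField_left : HasSimpleOPE 1 0 (idField R V) t := fun i j v => by
  simp [idField_apply, apply_ite (t j)]

theorem hasSimpleOPE_idField_right : HasSimpleOPE 1 0 s (idField R V) := fun i j v => by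
  simp [idField_apply, apply_ite (s i)]

theorem HasSimpleOPE.nord_shift_shift {ε c : R} (h : HasSimpleOPE ε c s t) (l m : ℤ) :
    nord ε (shift m s) (shift (l - m) t) =
      nord ε s (shift l t) + (m * c : R) • shift (l - 1) (idField R V) := by
  have step (m : ℤ) : nord ε (shift (m + 1) s) (shift (l - (m + 1)) t) =
      nord ε (shift m s) (shift (l - m) t) + c • shift (l - 1) (idField R V) := by
    refine fields_ext fun k v => ?_
    have hmove := nord_shift_one (shift m s) (shift (l - (m + 1)) t) k v ε
    rw [shift_shift, shift_shift, add_comm 1 m, show 1 + (l - (m + 1)) = l - m by ring] at hmove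
    rw [hmove, shift_apply, shift_apply, h, add_sub_cancel_left]
    have hiff : 0 + m + (k + (l - (m + 1))) = -1 ↔ k + (l - 1) = -1 := by omega
    simp only [hiff]
    simp [shift_apply, idField_apply]
  induction m using Int.induction_on with
  | zero => simp [shift_zero]
  | succ m ih =>
    rw [step, ih]
    push_cast
    module
  | pred m ih =>
    have hpred := step (-m - 1)
    rw [sub_add_cancel, ih, ← sub_eq_iff_eq_add] at hpred
    rw [← hpred]
    push_cast
    module

theorem HasSimpleOPE.nord_shift {ε c : R} (h : HasSimpleOPE ε c s t) (m : ℤ) :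
    nord ε (shift m s) t = nord ε s (shift m t) + (m * c : R) • shift (m - 1) (idField R V) := by
  simpa only [sub_self, shift_zero] using h.nord_shift_shift m m

variable (s) in
theorem nord_shift_idField_right (m : ℤ) : nord 1 s (shift m (idField R V)) = shift m s := by
  simpa [nord_idField_right] using (hasSimpleOPE_idField_right (s := s)).nord_shift m |>.symm

variable (t) in
theorem nord_shift_idField_left (m : ℤ) : nord 1 (shift m (idField R V)) t = shift m t := by
  simpa [nord_idField_left] using (hasSimpleOPE_idField_left (t := t)).nord_shift m

end SimpleOPE

section Leibniz

variable {s t} {s' t' : fields R V} {A : Module.End R V}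

theorem map_creMul {α β : R} (hs : ∀ k v, A (s k v) = α • s k (A v) + s' k v)
    (ht : ∀ k v, A (t k v) = β • t k (A v) + t' k v) (k : ℤ) (v : V) :
    A (creMul R V s t k v) = (α * β) • creMul R V s t k (A v) + α • creMul R V s t' k v +
      creMul R V s' t k v := by
  have h₁ := eventually_creMul s t k (A v)
  have h₂ := eventually_creMul s t' k v
  have h₃ := eventually_creMul s' t k v
  rw [map_creMul_apply, creMul_apply, creMul_apply, creMul_apply,
    smul_finsum' _ (hasFiniteSupport_of_eventually h₁),
    smul_finsum' _ (hasFiniteSupport_of_eventually h₂),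
    ← finsum_add_distrib, ← finsum_add_distrib]
  · simp only [hs, ht, map_add, map_smul, smul_add, mul_smul]
  all_goals
    refine hasFiniteSupport_of_eventually ?_
    filter_upwards [h₁, h₂, h₃] with j hj₁ hj₂ hj₃
    simp [hj₁, hj₂, hj₃]

theorem map_annMul {α β : R} (hs : ∀ k v, A (s k v) = α • s k (A v) + s' k v)
    (ht : ∀ k v, A (t k v) = β • t k (A v) + t' k v) (k : ℤ) (v : V) :
    A (annMul R V s t k v) = (β * α) • annMul R V s t k (A v) + β • annMul R V s' t k v +
      annMul R V s t' k v := by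
  have h₁ := eventually_annMul s t k (A v)
  have h₂ := eventually_annMul s' t k v
  have h₃ := eventually_annMul s t' k v
  rw [map_annMul_apply, annMul_apply, annMul_apply, annMul_apply,
    smul_finsum' _ (hasFiniteSupport_of_eventually h₁),
    smul_finsum' _ (hasFiniteSupport_of_eventually h₂),
    ← finsum_add_distrib, ← finsum_add_distrib]
  · simp only [hs, ht, map_add, map_smul, smul_add, mul_smul]
  all_goals
    refine hasFiniteSupport_of_eventually ?_
    filter_upwards [h₁, h₂, h₃] with j hj₁ hj₂ hj₃
    simp [hj₁, hj₂, hj₃]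

theorem map_nord {α β : R} (ε : R) (hα : α * α = 1)
    (hs : ∀ k v, A (s k v) = α • s k (A v) + s' k v)
    (ht : ∀ k v, A (t k v) = β • t k (A v) + t' k v) (k : ℤ) (v : V) :
    A (nord ε s t k v) = (α * β) • nord ε s t k (A v) + α • nord (α * ε) s t' k v +
      nord (β * ε) s' t k v := by
  simp only [nord_apply, map_add, map_smul, map_creMul hs ht, map_annMul hs ht]
  linear_combination (norm := module) -hα • ε • annMul R V s t' k v

theorem map_nord_of_comm {α β : R} (ε : R) (hα : α * α = 1)
    (hs : ∀ k v, A (s k v) = α • s k (A v)) (ht : ∀ k v, A (t k v) = β • t k (A v))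
    (k : ℤ) (v : V) : A (nord ε s t k v) = (α * β) • nord ε s t k (A v) := by
  simpa using map_nord (s' := 0) (t' := 0) ε hα (by simpa using hs) (by simpa using ht) k v

theorem HasSimpleOPE.apply_nord {r : fields R V} {ε α β a b : R} (hα : α * α = 1)
    (hs : HasSimpleOPE α a r s) (ht : HasSimpleOPE β b r t) (ha : a ≠ 0 → β * ε = 1)
    (hb : b ≠ 0 → α * ε = 1) (p k : ℤ) (v : V) :
    r p (nord ε s t k v) =
      (α * β) • nord ε s t k (r p v) + (α * b) • s (k + p) v + a • t (k + p) v := by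
  have central {η c : R} {x : fields R V} (hx : HasSimpleOPE η c r x) (k : ℤ) (v : V) :
      r p (x k v) = η • x k (r p v) + (c • shift p (idField R V)) k v := by
    rw [hx p k v, add_comm p k]
    simp [shift_apply, idField_apply]
  have hs' : nord (β * ε) (a • shift p (idField R V)) t = a • shift p t := by
    rcases eq_or_ne a 0 with rfl | h
    · simp
    · simp [ha h, nord_shift_idField_left]
  have ht' : nord (α * ε) s (b • shift p (idField R V)) = b • shift p s := by
    rcases eq_or_ne b 0 with rfl | h
    · simp
    · simp [hb h, nord_shift_idField_right]
  rw [map_nord ε hα (central hs) (central ht), hs', ht']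
  simp [shift_apply, mul_smul]

end Leibniz

end Fields

variable {n : ℕ}

/-! ### Creation and annihilation operators -/

/-- The basis vectors of the Fock space. -/
def ket (o : Occ n) : Fock n := Finsupp.single o 1

theorem linearMap_ext_ket {M : Type*} [AddCommMonoid M] [Module ℂ M] {f g : Fock n →ₗ[ℂ] M}
    (h : ∀ o, f (ket o) = g (ket o)) : f = g := by
  refine Finsupp.lhom_ext' fun o => LinearMap.ext_ring ?_
  simpa [ket] using h o

theorem evenCre_ket (s : EvenMode n) (o : Occ n) :
    evenCre s (ket o) = ket (o.1 + Finsupp.single s 1, o.2) := by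
  simp [evenCre, ket]

theorem evenAnn_ket (s : EvenMode n) (o : Occ n) :
    evenAnn s (ket o) = (o.1 s : ℂ) • ket (o.1 - Finsupp.single s 1, o.2) := by
  simp [evenAnn, ket]

theorem oddCre_ket (s : OddMode n) (o : Occ n) :
    oddCre s (ket o) = if s ∈ o.2 then 0 else oddSign s o.2 • ket (o.1, insert s o.2) := by
  simp [oddCre, ket]

theorem oddAnn_ket (s : OddMode n) (o : Occ n) :
    oddAnn s (ket o) = if s ∈ o.2 then oddSign s o.2 • ket (o.1, o.2.erase s) else 0 := by
  simp [oddAnn, ket]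

theorem evenCre_evenCre (s t : EvenMode n) : evenCre s * evenCre t = evenCre t * evenCre s := by
  refine linearMap_ext_ket fun o => ?_
  simp [Module.End.mul_apply, evenCre_ket, add_assoc, add_comm (Finsupp.single s 1)]

theorem evenAnn_evenAnn (s t : EvenMode n) : evenAnn s * evenAnn t = evenAnn t * evenAnn s := by
  refine linearMap_ext_ket fun o => ?_
  rcases eq_or_ne s t with rfl | h
  · rfl
  simp [Module.End.mul_apply, evenAnn_ket, smul_smul, tsub_tsub, add_comm (Finsupp.single s 1),
    h, h.symm, mul_comm]

theorem evenAnn_evenCre (s t : EvenMode n) :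
    evenAnn s * evenCre t = evenCre t * evenAnn s + if s = t then 1 else 0 := by
  refine linearMap_ext_ket fun o => ?_
  rcases eq_or_ne s t with rfl | h
  · have hs : (o.1 s : ℂ) • ket (o.1 - Finsupp.single s 1 + Finsupp.single s 1, o.2) =
        (o.1 s : ℂ) • ket o := by
      rcases Nat.eq_zero_or_pos (o.1 s) with h0 | h0
      · simp [h0]
      · rw [tsub_add_cancel_of_le (Finsupp.single_le_iff.2 h0)]
    simp [Module.End.mul_apply, evenAnn_ket, evenCre_ket, hs, add_smul]
  · have ht : (o.1 s : ℂ) • ket (o.1 + Finsupp.single t 1 - Finsupp.single s 1, o.2) =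
        (o.1 s : ℂ) • ket (o.1 - Finsupp.single s 1 + Finsupp.single t 1, o.2) := by
      rcases Nat.eq_zero_or_pos (o.1 s) with h0 | h0
      · simp [h0]
      · rw [tsub_add_eq_add_tsub (Finsupp.single_le_iff.2 h0)]
    simp [Module.End.mul_apply, evenAnn_ket, evenCre_ket, h, ht]

theorem evenCre_oddCre (s : EvenMode n) (t : OddMode n) :
    evenCre s * oddCre t = oddCre t * evenCre s := by
  refine linearMap_ext_ket fun o => ?_
  by_cases h : t ∈ o.2 <;> simp [Module.End.mul_apply, evenCre_ket, oddCre_ket, h]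

theorem evenCre_oddAnn (s : EvenMode n) (t : OddMode n) :
    evenCre s * oddAnn t = oddAnn t * evenCre s := by
  refine linearMap_ext_ket fun o => ?_
  by_cases h : t ∈ o.2 <;> simp [Module.End.mul_apply, evenCre_ket, oddAnn_ket, h]

theorem evenAnn_oddCre (s : EvenMode n) (t : OddMode n) :
    evenAnn s * oddCre t = oddCre t * evenAnn s := by
  refine linearMap_ext_ket fun o => ?_
  by_cases h : t ∈ o.2 <;>
    simp [Module.End.mul_apply, evenAnn_ket, oddCre_ket, h, smul_smul, mul_comm]

theorem evenAnn_oddAnn (s : EvenMode n) (t : OddMode n) :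
    evenAnn s * oddAnn t = oddAnn t * evenAnn s := by
  refine linearMap_ext_ket fun o => ?_
  by_cases h : t ∈ o.2 <;>
    simp [Module.End.mul_apply, evenAnn_ket, oddAnn_ket, h, smul_smul, mul_comm]

theorem oddSign_mul_self (s : OddMode n) (S : Finset (OddMode n)) :
    oddSign s S * oddSign s S = 1 := by
  rw [oddSign, ← mul_pow]
  simp

theorem oddSign_insert (s t : OddMode n) {S : Finset (OddMode n)} (h : t ∉ S) :
    oddSign s (insert t S) = (if t < s then -1 else 1) * oddSign s S := by
  unfold oddSign
  rw [Finset.filter_insert]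
  split_ifs
  · rw [Finset.card_insert_of_notMem (by simp [h]), pow_succ']
  · simp

theorem oddSign_erase (s t : OddMode n) {S : Finset (OddMode n)} (h : t ∈ S) :
    oddSign s (S.erase t) = (if t < s then -1 else 1) * oddSign s S := by
  conv_rhs => rw [← Finset.insert_erase h, oddSign_insert s t (Finset.notMem_erase t S)]
  split_ifs <;> simp

theorem oddCre_oddCre (s t : OddMode n) : oddCre s * oddCre t = -(oddCre t * oddCre s) := by
  refine linearMap_ext_ket fun o => ?_
  rcases eq_or_ne s t with rfl | hst
  · by_cases h : s ∈ o.2 <;> simp [Module.End.mul_apply, oddCre_ket, h]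
  · have hlt : (if t < s then (-1 : ℂ) else 1) = -if s < t then -1 else 1 := by
      rcases lt_or_gt_of_ne hst with h | h <;> simp [h, h.not_gt]
    by_cases h : s ∈ o.2 <;> by_cases h' : t ∈ o.2 <;>
      simp [Module.End.mul_apply, oddCre_ket, h, h', hst, hst.symm, smul_smul, oddSign_insert, hlt,
        Finset.insert_comm s t, mul_comm]

theorem oddAnn_oddAnn (s t : OddMode n) : oddAnn s * oddAnn t = -(oddAnn t * oddAnn s) := by
  refine linearMap_ext_ket fun o => ?_
  rcases eq_or_ne s t with rfl | hst
  · by_cases h : s ∈ o.2 <;> simp [Module.End.mul_apply, oddAnn_ket, h]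
  · have hlt : (if t < s then (-1 : ℂ) else 1) = -if s < t then -1 else 1 := by
      rcases lt_or_gt_of_ne hst with h | h <;> simp [h, h.not_gt]
    by_cases h : s ∈ o.2 <;> by_cases h' : t ∈ o.2 <;>
      simp [Module.End.mul_apply, oddAnn_ket, h, h', hst, hst.symm, smul_smul, oddSign_erase, hlt,
        Finset.erase_right_comm (a := s) (b := t), mul_comm]

theorem oddAnn_oddCre (s t : OddMode n) :
    oddAnn s * oddCre t = -(oddCre t * oddAnn s) + if s = t then 1 else 0 := by
  refine linearMap_ext_ket fun o => ?_
  rcases eq_or_ne s t with rfl | hst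
  · by_cases h : s ∈ o.2
    · simp [Module.End.mul_apply, oddCre_ket, oddAnn_ket, h, smul_smul, oddSign_erase,
        oddSign_mul_self, Finset.insert_erase]
    · simp [Module.End.mul_apply, oddCre_ket, oddAnn_ket, h, smul_smul, oddSign_insert,
        oddSign_mul_self]
  · have hlt : (if t < s then (-1 : ℂ) else 1) = -if s < t then -1 else 1 := by
      rcases lt_or_gt_of_ne hst with h | h <;> simp [h, h.not_gt]
    by_cases h : s ∈ o.2 <;> by_cases h' : t ∈ o.2 <;>
      simp [Module.End.mul_apply, oddCre_ket, oddAnn_ket, h, h', hst, hst.symm, smul_smul,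
        oddSign_insert, oddSign_erase, hlt, Finset.erase_insert_of_ne, mul_comm]

/-- The sign for exchanging two fields; the right summand is the odd one. -/
def exchangeSign {α β γ δ : Type*} (s : α ⊕ β) (t : γ ⊕ δ) : ℂ :=
  if s.isRight ∧ t.isRight then -1 else 1

section ExchangeSign

variable {α β γ δ : Type*} (s : α ⊕ β) (t : γ ⊕ δ)

theorem exchangeSign_comm : exchangeSign s t = exchangeSign t s := by
  simp only [exchangeSign, and_comm]

theorem exchangeSign_mul_self : exchangeSign s t * exchangeSign s t = 1 := by
  unfold exchangeSign
  split_ifs <;> simp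

end ExchangeSign

/-- The operator creating a letter. -/
def letterCre : Letter n → Module.End ℂ (Fock n) := Sum.elim evenCre oddCre

/-- The derivative with respect to a letter. -/
def letterAnn : Letter n → Module.End ℂ (Fock n) := Sum.elim evenAnn oddAnn

theorem letterCre_letterCre (s t : Letter n) (v : Fock n) :
    letterCre s (letterCre t v) = exchangeSign s t • letterCre t (letterCre s v) := by
  rcases s with s | s <;> rcases t with t | t
  · simpa [letterCre, exchangeSign] using congr($(evenCre_evenCre s t) v)
  · simpa [letterCre, exchangeSign] using congr($(evenCre_oddCre s t) v)
  · simpa [letterCre, exchangeSign] using congr($(evenCre_oddCre t s) v).symm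
  · simpa [letterCre, exchangeSign] using congr($(oddCre_oddCre s t) v)

theorem letterAnn_letterAnn (s t : Letter n) (v : Fock n) :
    letterAnn s (letterAnn t v) = exchangeSign s t • letterAnn t (letterAnn s v) := by
  rcases s with s | s <;> rcases t with t | t
  · simpa [letterAnn, exchangeSign] using congr($(evenAnn_evenAnn s t) v)
  · simpa [letterAnn, exchangeSign] using congr($(evenAnn_oddAnn s t) v)
  · simpa [letterAnn, exchangeSign] using congr($(evenAnn_oddAnn t s) v).symm
  · simpa [letterAnn, exchangeSign] using congr($(oddAnn_oddAnn s t) v)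

theorem letterAnn_letterCre (s t : Letter n) (v : Fock n) : letterAnn s (letterCre t v) =
    exchangeSign s t • letterCre t (letterAnn s v) + if s = t then v else 0 := by
  rcases s with s | s <;> rcases t with t | t
  · have h := congr($(evenAnn_evenCre s t) v)
    split_ifs at h ⊢ <;> simp_all [letterAnn, letterCre, exchangeSign]
  · simpa [letterAnn, letterCre, exchangeSign] using congr($(evenAnn_oddCre s t) v)
  · simpa [letterAnn, letterCre, exchangeSign] using congr($(evenCre_oddAnn t s) v).symm
  · have h := congr($(oddAnn_oddCre s t) v)
    split_ifs at h ⊢ <;> simp_all [letterAnn, letterCre, exchangeSign]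

theorem letterAnn_vac (s : Letter n) : letterAnn s vac = 0 := by
  rcases s with s | s
  · simp [letterAnn, evenAnn, vac]
  · simp [letterAnn, oddAnn, vac]

/-! ### Modes of the generating fields -/

/-- The generating fields, the bosonic ones on the left and the fermionic ones on the right. -/
abbrev Gen (n : ℕ) : Type := EvenGen n ⊕ OddGen n

/-- The letter `∂ ^ m g / m!`. -/
def letter (g : Gen n) (m : ℕ) : Letter n := g.map (fun a => toLex (a, m)) fun a => toLex (a, m)

theorem letter_inj {g h : Gen n} {m k : ℕ} : letter g m = letter h k ↔ g = h ∧ m = k := by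
  rcases g with g | g <;> rcases h with h | h <;> simp [letter]

theorem exists_letter_eq (s : Letter n) : ∃ g m, letter g m = s := by
  rcases s with s | s
  · exact ⟨.inl (ofLex s).1, (ofLex s).2, rfl⟩
  · exact ⟨.inr (ofLex s).1, (ofLex s).2, rfl⟩

theorem exchangeSign_letter_left {α β : Type*} (g : Gen n) (m : ℕ) (t : α ⊕ β) :
    exchangeSign (letter g m) t = exchangeSign g t := by
  simp [exchangeSign, letter]

theorem exchangeSign_letter_right {α β : Type*} (s : α ⊕ β) (g : Gen n) (m : ℕ) :
    exchangeSign s (letter g m) = exchangeSign s g := by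
  rw [exchangeSign_comm, exchangeSign_letter_left, exchangeSign_comm]

theorem eventually_letterAnn (g : Gen n) (v : Fock n) :
    ∀ᶠ k : ℕ in atTop, letterAnn (letter g k) v = 0 := by
  induction v using Finsupp.induction_linear with
  | zero => simp
  | add v w hv hw =>
    filter_upwards [hv, hw] with k hkv hkw
    rw [map_add, hkv, hkw, add_zero]
  | single o z =>
    have hket : (Finsupp.single o z : Fock n) = z • ket o := by simp [ket]
    rcases g with a | a
    · have hfin := o.1.hasFiniteSupport.preimage
        (f := fun k : ℕ => (toLex (a, k) : EvenMode n)) fun k _ l _ h => by simpa using h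
      rw [← Nat.cofinite_eq_atTop]
      filter_upwards [hfin.compl_mem_cofinite] with k hk
      have hk' : o.1 (toLex (a, k)) = 0 := by simpa using hk
      simp [hket, letterAnn, letter, evenAnn_ket, hk']
    · have hfin := o.2.finite_toSet.preimage
        (f := fun k : ℕ => (toLex (a, k) : OddMode n)) fun k _ l _ h => by simpa using h
      rw [← Nat.cofinite_eq_atTop]
      filter_upwards [hfin.compl_mem_cofinite] with k hk
      have hk' : toLex (a, k) ∉ o.2 := by simpa using hk
      simp [hket, letterAnn, letter, oddAnn_ket, hk']

/-- The only generator having a nontrivial operator product expansion with a given one. -/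
def dual : Gen n → Gen n
  | .inl (.X i) => .inl (.Y i)
  | .inl (.Y i) => .inl (.X i)
  | .inr (.psi i) => .inr (.chi i)
  | .inr (.chi i) => .inr (.psi i)
  | .inr (.b a) => .inr (.c a)
  | .inr (.c a) => .inr (.b a)

/-- The coefficient of the simple pole of `g(z) (dual g)(0)`. -/
def dualSign : Gen n → ℂ
  | .inl (.Y _) => -1
  | _ => 1

/-- The coefficient of the simple pole of `g(z) h(0)`. -/
def pairing (g h : Gen n) : ℂ :=
  open scoped Classical in if dual g = h then dualSign g else 0

theorem exchangeSign_dual_left {α β : Type*} (g : Gen n) (t : α ⊕ β) :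
    exchangeSign (dual g) t = exchangeSign g t := by
  rcases g with (_ | _) | (_ | _ | _ | _) <;> rfl

theorem dual_dual (g : Gen n) : dual (dual g) = g := by
  rcases g with (_ | _) | (_ | _ | _ | _) <;> rfl

theorem dualSign_dual (g : Gen n) : dualSign (dual g) = -exchangeSign g g * dualSign g := by
  rcases g with (_ | _) | (_ | _ | _ | _) <;> simp [dual, dualSign, exchangeSign]

theorem pairing_comm (g h : Gen n) : pairing g h = -exchangeSign g h * pairing h g := by
  unfold pairing
  rcases eq_or_ne (dual g) h with rfl | hgh
  · rw [if_pos rfl, if_pos (dual_dual g), dualSign_dual, exchangeSign_comm, exchangeSign_dual_left]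
    linear_combination -dualSign g * exchangeSign_mul_self g g
  · rw [if_neg hgh, if_neg fun h' => hgh (by rw [← h', dual_dual]), mul_zero]

/-- The modes of a generating field. -/
def genMode : Gen n → ℤ → Module.End ℂ (Fock n) := Sum.elim evenMode oddMode

theorem genMode_negSucc (g : Gen n) (m : ℕ) :
    genMode g (Int.negSucc m) = letterCre (letter g m) := by
  rcases g with _ | _ <;> rfl

theorem genMode_natCast (g : Gen n) (m : ℕ) :
    genMode g m = dualSign g • letterAnn (letter (dual g) m) := by
  refine LinearMap.ext fun v => ?_
  rcases g with (_ | _) | (_ | _ | _ | _)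
  case inl.Y => exact (neg_one_smul ℂ _).symm
  all_goals exact (one_smul ℂ _).symm

theorem genMode_vac (g : Gen n) (m : ℕ) : genMode g m vac = 0 := by
  rw [genMode_natCast, LinearMap.smul_apply, letterAnn_vac, smul_zero]

/-- A generator as a field. -/
def genField (g : Gen n) : fields ℂ (Fock n) :=
  ⟨genMode g, fun v => by
    have h := (eventually_letterAnn (dual g) v).mono fun k hk =>
      show genMode g k v = 0 by rw [genMode_natCast, LinearMap.smul_apply, hk, smul_zero]
    rw [← Nat.map_cast_int_atTop]
    exact h⟩

theorem genField_apply (g : Gen n) (k : ℤ) : genField g k = genMode g k := rfl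

theorem genMode_natCast_negSucc (g h : Gen n) (p q : ℕ) (v : Fock n) :
    genMode g p (genMode h (Int.negSucc q) v) =
      exchangeSign g h • genMode h (Int.negSucc q) (genMode g p v) +
        (if p = q then pairing g h else 0) • v := by
  rw [genMode_natCast, genMode_negSucc, LinearMap.smul_apply, letterAnn_letterCre,
    LinearMap.smul_apply, map_smul, exchangeSign_letter_left, exchangeSign_letter_right,
    exchangeSign_dual_left, smul_add, smul_comm]
  congr 1
  by_cases hgh : dual g = h <;> by_cases hpq : p = q <;> simp [letter_inj, pairing, hgh, hpq]

theorem genField_hasSimpleOPE (g h : Gen n) :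
    HasSimpleOPE (exchangeSign g h) (pairing g h) (genField g) (genField h) := by
  intro p q v
  simp only [genField_apply]
  rcases p with p | p <;> rcases q with q | q
  · have hpq : (p + q : ℤ) ≠ -1 := by omega
    simp [genMode_natCast, letterAnn_letterAnn (letter (dual g) p), exchangeSign_letter_left,
      exchangeSign_letter_right, exchangeSign_dual_left, exchangeSign_comm g, hpq, smul_smul,
      mul_comm, mul_left_comm]
  · have hpq : (p : ℤ) + Int.negSucc q = -1 ↔ p = q := by omega
    simp only [Int.ofNat_eq_natCast, hpq]
    exact genMode_natCast_negSucc g h p q v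
  · have hpq : Int.negSucc p + (q : ℤ) = -1 ↔ q = p := by omega
    simp only [Int.ofNat_eq_natCast, hpq, genMode_natCast_negSucc h g, exchangeSign_comm h,
      pairing_comm g h]
    split_ifs <;> linear_combination (norm := module) -exchangeSign_mul_self g h •
      genMode g (Int.negSucc p) (genMode h q v)
  · have hpq : Int.negSucc p + Int.negSucc q ≠ -1 := by omega
    simp [genMode_negSucc, letterCre_letterCre (letter g p), exchangeSign_letter_left,
      exchangeSign_letter_right, hpq]

/-! ### The state-field correspondence -/

theorem letterMode_letter (g : Gen n) (m : ℕ) (k : ℤ) :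
    letterMode (letter g m) k = ((-1) ^ m * Ring.choose k m : ℤ) • genMode g (k - m) := by
  rcases g with a | a <;> exact LinearMap.ext fun v => Int.cast_smul_eq_zsmul ℂ _ (_ : Fock n)

theorem eventually_letterMode (s : Letter n) (v : Fock n) :
    ∀ᶠ k : ℤ in atTop, letterMode s k v = 0 := by
  obtain ⟨g, m, rfl⟩ := exists_letter_eq s
  have h := (tendsto_atTop_add_const_right _ (-m : ℤ) tendsto_id).eventually ((genField g).2 v)
  filter_upwards [h] with k hk
  rw [letterMode_letter, LinearMap.smul_apply, sub_eq_add_neg]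
  exact (congrArg _ hk).trans (smul_zero _)

/-- A letter as a field. -/
def letterField (s : Letter n) : fields ℂ (Fock n) := ⟨letterMode s, eventually_letterMode s⟩

theorem letterField_letter (g : Gen n) (m : ℕ) (k : ℤ) (v : Fock n) :
    letterField (letter g m) k v = ((-1) ^ m * Ring.choose k m : ℤ) • genField g (k - m) v :=
  congr($(letterMode_letter g m k) v)

theorem letterField_letter_zero (g : Gen n) : letterField (letter g 0) = genField g :=
  fields_ext fun k v => by simp [letterField_letter]

theorem letterField_neg_comm (s t : Letter n) (i j : ℕ) (v : Fock n) :
    letterField s (-1 - i) (letterField t (-1 - j) v) =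
      exchangeSign s t • letterField t (-1 - j) (letterField s (-1 - i) v) := by
  obtain ⟨g, m, rfl⟩ := exists_letter_eq s
  obtain ⟨h, l, rfl⟩ := exists_letter_eq t
  have hij : (-1 - i - m : ℤ) + (-1 - j - l) ≠ -1 := by omega
  simp only [letterField_letter, map_zsmul, (genField_hasSimpleOPE g h).apply_comm hij,
    exchangeSign_letter_left, exchangeSign_letter_right]
  module

theorem letterField_natCast (g : Gen n) (m j : ℕ) : ∃ (z : ℤ) (k : ℕ), ∀ v,
    letterField (letter g m) j v = z • genField g k v := by
  rcases lt_or_ge j m with hjm | hjm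
  · refine ⟨0, 0, fun v => ?_⟩
    rw [letterField_letter, Ring.choose_natCast, Nat.choose_eq_zero_of_lt hjm]
    simp
  · exact ⟨_, j - m, fun v => by rw [letterField_letter, Nat.cast_sub hjm]⟩

theorem letterField_natCast_comm (s t : Letter n) (i j : ℕ) (v : Fock n) :
    letterField s i (letterField t j v) =
      exchangeSign s t • letterField t j (letterField s i v) := by
  obtain ⟨g, m, rfl⟩ := exists_letter_eq s
  obtain ⟨h, l, rfl⟩ := exists_letter_eq t
  obtain ⟨y, i', hi⟩ := letterField_natCast g m i
  obtain ⟨z, j', hj⟩ := letterField_natCast h l j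
  have hij : (i' + j' : ℤ) ≠ -1 := by omega
  simp only [hi, hj, map_zsmul, (genField_hasSimpleOPE g h).apply_comm hij,
    exchangeSign_letter_left, exchangeSign_letter_right]
  module

/-- The field of the nested normally ordered product of the letters of a word. -/
def wordField : List (Letter n) → fields ℂ (Fock n)
  | [] => idField ℂ (Fock n)
  | s :: l => nord (letterSign s l) (letterField s) (wordField l)

theorem wordMode_eq (l : List (Letter n)) (k : ℤ) (v : Fock n) :
    wordMode l k v = wordField l k v := by
  induction l generalizing k v with
  | nil => rw [wordField, idField_apply, wordMode]
  | cons s l ih =>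
    rw [wordField, nord_apply, wordMode]
    simp only [ih]
    rfl

theorem letterSign_cons (s t : Letter n) (l : List (Letter n)) :
    letterSign s (t :: l) = exchangeSign s t * letterSign s l := by
  rcases s with s | s <;> rcases t with t | t <;>
    simp [letterSign, exchangeSign, List.filter_cons, pow_succ]

theorem letterSign_perm (s : Letter n) {l l' : List (Letter n)} (h : l.Perm l') :
    letterSign s l = letterSign s l' := by
  unfold letterSign
  rw [(h.filter _).length_eq]

theorem wordField_swap (s t : Letter n) (l : List (Letter n)) :
    wordField (s :: t :: l) = exchangeSign s t • wordField (t :: s :: l) := by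
  simp only [wordField, letterSign_cons, exchangeSign_comm t s]
  exact nord_nord_comm _ (exchangeSign_mul_self s t) _ _ (letterField_neg_comm s t) fun i j v => by
    rw [exchangeSign_comm, letterField_natCast_comm]

theorem wordField_append_cons (s : Letter n) (l₁ l₂ : List (Letter n)) :
    wordField (l₁ ++ s :: l₂) = letterSign s l₁ • wordField (s :: (l₁ ++ l₂)) := by
  induction l₁ with
  | nil => simp [letterSign]
  | cons t l₁ ih =>
    rw [List.cons_append, wordField, ih, letterSign_perm t List.perm_middle, map_smul, ← wordField,
      wordField_swap, smul_smul, letterSign_cons, exchangeSign_comm, mul_comm]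
    rfl

theorem wordField_eq_zero (s : OddMode n) {l : List (Letter n)} (h : .inr s ∈ l) :
    wordField (.inr s :: l) = 0 := by
  obtain ⟨l₁, l₂, rfl⟩ := List.append_of_mem h
  have hss : wordField (.inr s :: .inr s :: (l₁ ++ l₂)) = 0 := by
    have hswap := wordField_swap (.inr s) (.inr s) (l₁ ++ l₂)
    exact fields_ext fun k v => self_eq_neg.1 (by simpa [exchangeSign] using congr($hswap k v))
  rw [wordField, wordField_append_cons, letterSign_perm _ List.perm_middle, map_smul, ← wordField,
    hss, smul_zero]

section Sorting

variable {α : Type*} [LinearOrder α]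

theorem exists_sort_cons_eq (a : α) (m : Multiset α) : ∃ l₁ l₂,
    (a ::ₘ m).sort (· ≤ ·) = l₁ ++ a :: l₂ ∧ m.sort (· ≤ ·) = l₁ ++ l₂ := by
  obtain ⟨l₁, l₂, h⟩ := List.append_of_mem
    ((Multiset.mem_sort (· ≤ ·)).2 (Multiset.mem_cons_self a m))
  refine ⟨l₁, l₂, h, ?_⟩
  have hsorted := Multiset.pairwise_sort (a ::ₘ m) (· ≤ ·)
  rw [h] at hsorted
  refine List.Perm.eq_of_pairwise' (Multiset.pairwise_sort m _)
    (hsorted.sublist ((List.sublist_cons_self a l₂).append_left l₁)) (List.perm_cons a |>.1 ?_)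
  refine List.Perm.trans (Multiset.coe_eq_coe.1 ?_) List.perm_middle
  rw [← h]
  simp [← Multiset.cons_coe]

theorem exists_sort_insert_eq (a : α) {S : Finset α} (ha : a ∉ S) : ∃ l₁ l₂,
    (insert a S).sort (· ≤ ·) = l₁ ++ a :: l₂ ∧ S.sort (· ≤ ·) = l₁ ++ l₂ ∧
      (S.filter (· < a)).card = l₁.length := by
  obtain ⟨l₁, l₂, h, h'⟩ := exists_sort_cons_eq a S.val
  rw [← Finset.insert_val_of_notMem ha] at h
  refine ⟨l₁, l₂, h, h', ?_⟩
  have hlt : (l₁ ++ a :: l₂).Pairwise (· < ·) := by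
    rw [← h]
    exact (Finset.sortedLT_sort _).pairwise
  have hS (x : α) : x ∈ S ↔ x ∈ l₁ ∨ x ∈ l₂ := by
    rw [← List.mem_append, ← h']
    exact (Multiset.mem_sort _).symm
  obtain ⟨hl₁, hl₂, hlt₂⟩ := List.pairwise_append.1 hlt
  have hfilter : S.filter (· < a) = l₁.toFinset := by
    ext x
    have h₁ (hx : x ∈ l₁) : x < a := hlt₂ x hx a List.mem_cons_self
    have h₂ (hx : x ∈ l₂) : ¬x < a := (List.rel_of_pairwise_cons hl₂ hx).not_gt
    rw [Finset.mem_filter, hS, List.mem_toFinset]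
    tauto
  rw [hfilter, List.toFinset_card_of_nodup (hl₁.imp ne_of_lt)]

end Sorting

theorem word_evenCre (s : EvenMode n) (o : Occ n) : ∃ l₁ l₂,
    Occ.word (o.1 + Finsupp.single s 1, o.2) = l₁ ++ .inl s :: l₂ ∧ o.word = l₁ ++ l₂ := by
  obtain ⟨l₁, l₂, h, h'⟩ := exists_sort_cons_eq s (Finsupp.toMultiset o.1)
  refine ⟨l₁.map .inl, l₂.map .inl ++ (o.2.sort (· ≤ ·)).map .inr, ?_, ?_⟩
  · simp [Occ.word, h, Multiset.add_comm _ {s}]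
  · simp [Occ.word, h']

theorem word_oddCre (s : OddMode n) (o : Occ n) (hs : s ∉ o.2) : ∃ l₁ l₂,
    Occ.word (o.1, insert s o.2) = l₁ ++ .inr s :: l₂ ∧ o.word = l₁ ++ l₂ ∧
      letterSign (.inr s) l₁ = oddSign s o.2 := by
  obtain ⟨l₁, l₂, h, h', hcard⟩ := exists_sort_insert_eq s hs
  refine ⟨((Finsupp.toMultiset o.1).sort (· ≤ ·)).map .inl ++ l₁.map .inr, l₂.map .inr, ?_, ?_, ?_⟩
  · simp [Occ.word, h]
  · simp [Occ.word, h']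
  · simp [letterSign, oddSign, hcard, List.filter_map, Function.comp_def]

theorem mem_word_inr (s : OddMode n) (o : Occ n) : .inr s ∈ o.word ↔ s ∈ o.2 := by
  simp [Occ.word]

/-- The field of a state. -/
def stateField : Fock n →ₗ[ℂ] fields ℂ (Fock n) :=
  Finsupp.linearCombination ℂ fun o : Occ n => wordField o.word

theorem stateField_ket (o : Occ n) : stateField (ket o) = wordField o.word := by
  simp [stateField, ket]

theorem stateField_vac : stateField (vac : Fock n) = idField ℂ (Fock n) :=
  (stateField_ket _).trans (by simp [Occ.word, wordField])

theorem mode_eq (u : Fock n) (k : ℤ) (v : Fock n) : mode u k v = stateField u k v := by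
  induction u using Finsupp.induction_linear with
  | zero => simp [mode]
  | add f g hf hg =>
    have mode_add : mode (f + g) k v = mode f k v + mode g k v :=
      Finsupp.sum_add_index' (by simp) (fun o a b => by rw [add_smul])
    rw [mode_add, hf, hg, map_add]
    rfl
  | single o z => simp [mode, stateField, wordMode_eq]

theorem nop_eq (u v : Fock n) : nop u v = stateField u (-1) v := by
  rw [nop, opProd, mode_eq]
  rfl

theorem stateField_letterCre_ket (s : Letter n) (o : Occ n) :
    stateField (letterCre s (ket o)) = wordField (s :: o.word) := by
  rcases s with s | s
  · obtain ⟨l₁, l₂, h, h'⟩ := word_evenCre s o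
    rw [letterCre, Sum.elim_inl, evenCre_ket, stateField_ket, h, h', wordField_append_cons]
    simp [letterSign]
  · rw [letterCre, Sum.elim_inr, oddCre_ket]
    split_ifs with hs
    · rw [wordField_eq_zero s ((mem_word_inr s o).2 hs), map_zero]
    · obtain ⟨l₁, l₂, h, h', hsign⟩ := word_oddCre s o hs
      rw [map_smul, stateField_ket, h, h', wordField_append_cons, smul_smul, hsign,
        oddSign_mul_self, one_smul]

/-- The sign for exchanging a generator with a state. -/
def exchange (g : Gen n) : Module.End ℂ (Fock n) :=
  Finsupp.linearCombination ℂ fun o => letterSign (letter g 0) o.word • ket o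

theorem exchange_ket (g : Gen n) (o : Occ n) :
    exchange g (ket o) = letterSign (letter g 0) o.word • ket o := by
  simp [exchange, ket]

theorem exchange_vac (g : Gen n) : exchange g vac = vac :=
  (exchange_ket g _).trans (by simp [letterSign, Occ.word, ket, vac])

theorem exchange_letterCre (g : Gen n) (s : Letter n) (v : Fock n) :
    exchange g (letterCre s v) = exchangeSign g s • letterCre s (exchange g v) := by
  suffices h : exchange g ∘ₗ letterCre s = exchangeSign g s • letterCre s ∘ₗ exchange g from
    congr($h v)
  refine linearMap_ext_ket fun o => ?_
  rw [LinearMap.comp_apply, LinearMap.smul_apply, LinearMap.comp_apply, exchange_ket, map_smul]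
  rcases s with s | s
  · obtain ⟨l₁, l₂, h, h'⟩ := word_evenCre s o
    rw [letterCre, Sum.elim_inl, evenCre_ket, exchange_ket, h, h',
      letterSign_perm _ List.perm_middle, letterSign_cons, exchangeSign_letter_left, mul_smul]
  · rw [letterCre, Sum.elim_inr, oddCre_ket]
    split_ifs with hs
    · simp
    · obtain ⟨l₁, l₂, h, h', -⟩ := word_oddCre s o hs
      rw [map_smul, exchange_ket, h, h', letterSign_perm _ List.perm_middle, letterSign_cons,
        exchangeSign_letter_left]
      module

theorem genMode_neg_one (g : Gen n) : genMode g (-1) = letterCre (letter g 0) :=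
  genMode_negSucc g 0

theorem stateField_genMode {g : Gen n} {v : Fock n} {ε : ℂ} (hv : exchange g v = ε • v) :
    stateField (genMode g (-1) v) = nord ε (genField g) (stateField v) := by
  suffices h : stateField ∘ₗ genMode g (-1) = creMul ℂ (Fock n) (genField g) ∘ₗ stateField +
      annMul ℂ (Fock n) (genField g) ∘ₗ stateField ∘ₗ exchange g by
    simpa [hv, nord_eq] using congr($h v)
  refine linearMap_ext_ket fun o => ?_
  have h := stateField_letterCre_ket (letter g 0) o
  simp only [wordField, nord_eq, letterField_letter_zero, ← stateField_ket, ← map_smul,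
    ← exchange_ket, ← genMode_neg_one] at h
  exact h

theorem exchange_genMode {g h : Gen n} {v : Fock n} {ε : ℂ} (hv : exchange g v = ε • v) :
    exchange g (genMode h (-1) v) = (exchangeSign g h * ε) • genMode h (-1) v := by
  rw [genMode_neg_one, exchange_letterCre, hv, exchangeSign_letter_right, map_smul, mul_smul]

theorem stateField_gen (g : Gen n) : stateField (genMode g (-1) vac) = genField g := by
  rw [stateField_genMode (ε := 1) (by rw [exchange_vac, one_smul]), stateField_vac,
    nord_idField_right]

theorem nop_gen (g : Gen n) (v : Fock n) : nop (genMode g (-1) vac) v = genMode g (-1) v := by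
  rw [nop_eq, stateField_gen]
  rfl

theorem stateField_gen_gen (g h : Gen n) : stateField (genMode g (-1) (genMode h (-1) vac)) =
    nord (exchangeSign g h) (genField g) (genField h) := by
  rw [stateField_genMode (ε := exchangeSign g h), stateField_gen]
  simpa using exchange_genMode (g := g) (h := h) (ε := 1) (by rw [exchange_vac, one_smul])

/-! ### Currents -/

/-- The normally ordered product of two generators, as a field. -/
def genNord (g h : Gen n) : fields ℂ (Fock n) := nord (exchangeSign g h) (genField g) (genField h)

theorem stateField_nop_gen (g h : Gen n) :
    stateField (nop (genMode g (-1) vac) (genMode h (-1) vac)) = genNord g h := by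
  rw [nop_gen, stateField_gen_gen, genNord]

theorem genMode_genNord (r g h : Gen n) (p k : ℤ) (v : Fock n) :
    genMode r p (genNord g h k v) =
      (exchangeSign r g * exchangeSign r h) • genNord g h k (genMode r p v) +
        (exchangeSign r g * pairing r h) • genMode g (k + p) v +
          pairing r g • genMode h (k + p) v := by
  refine (genField_hasSimpleOPE r g).apply_nord (exchangeSign_mul_self r g)
    (genField_hasSimpleOPE r h) (fun hg => ?_) (fun hh => ?_) p k v
  · rw [← (ite_ne_right_iff.1 hg).1, exchangeSign_dual_left, exchangeSign_mul_self]
  · rw [← (ite_ne_right_iff.1 hh).1, exchangeSign_comm g, exchangeSign_dual_left,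
      exchangeSign_mul_self]

/-- The charge of a generator under the current `X i Y i + psi i chi i`. -/
def charge (i : Fin n) : Gen n → ℂ
  | .inl (.X j) => if i = j then -1 else 0
  | .inl (.Y j) => if i = j then 1 else 0
  | .inr (.psi j) => if i = j then 1 else 0
  | .inr (.chi j) => if i = j then -1 else 0
  | _ => 0

theorem charge_dual (i : Fin n) (g : Gen n) : charge i (dual g) = -charge i g := by
  rcases g with (_ | _) | (_ | _ | _ | _) <;> simp only [charge, dual] <;>
    (try split_ifs) <;> simp

theorem pairing_eq_zero_of_charge {i : Fin n} {g h : Gen n}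
    (hcharge : charge i g + charge i h ≠ 0) : pairing g h = 0 := by
  refine if_neg fun hgh => hcharge ?_
  rw [← hgh, charge_dual, add_neg_cancel]

/-- The field of the current `X i Y i + psi i chi i`. -/
def cur (i : Fin n) : fields ℂ (Fock n) :=
  genNord (.inl (.X i)) (.inl (.Y i)) + genNord (.inr (.psi i)) (.inr (.chi i))

theorem cur_apply (i : Fin n) (k : ℤ) (v : Fock n) : cur i k v =
    genNord (.inl (.X i)) (.inl (.Y i)) k v + genNord (.inr (.psi i)) (.inr (.chi i)) k v := rfl

theorem stateField_current (i : Fin n) : stateField (current i) = cur i := by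
  rw [current, map_add]
  exact congr($(stateField_nop_gen (.inl (.X i)) (.inl (.Y i))) +
    $(stateField_nop_gen (.inr (.psi i)) (.inr (.chi i))))

theorem cur_genMode (i : Fin n) (g : Gen n) (m p : ℤ) (v : Fock n) :
    cur i m (genMode g p v) = genMode g p (cur i m v) + charge i g • genMode g (p + m) v := by
  rw [cur_apply, cur_apply, map_add, genMode_genNord, genMode_genNord, add_comm m p]
  rcases g with (j | j) | (j | j | a | a)
  case inr.b | inr.c => simp [exchangeSign, pairing, dual, charge]
  all_goals
    rcases eq_or_ne i j with rfl | h
    · simp [exchangeSign, pairing, dual, dualSign, charge]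
      abel
    · simp [exchangeSign, pairing, dual, charge, h, h.symm]

theorem cur_genNord {i : Fin n} {g h : Gen n} (hcharge : charge i h = -charge i g)
    (m k : ℤ) (v : Fock n) : cur i m (genNord g h k v) = genNord g h k (cur i m v) +
      (if k + m = 0 then charge i g * m * pairing g h else 0) • v := by
  have leibniz (r : Gen n) (p : ℤ) (v : Fock n) : cur i m (genField r p v) =
      (1 : ℂ) • genField r p (cur i m v) + (charge i r • shift m (genField r)) p v := by
    rw [one_smul]
    exact cur_genMode i r m p v
  have hc : k + (m - 1) = -1 ↔ k + m = 0 := by omega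
  rw [genNord, map_nord _ (one_mul 1) (leibniz g) (leibniz h), hcharge]
  simp only [map_smul, LinearMap.smul_apply, one_mul, one_smul,
    (genField_hasSimpleOPE g h).nord_shift m]
  simp [shift_apply, idField_apply, hc, smul_smul, mul_assoc]

theorem cur_cur (i j : Fin n) (m k : ℤ) (v : Fock n) :
    cur i m (cur j k v) = cur j k (cur i m v) := by
  rw [cur_apply j, cur_apply j, map_add, cur_genNord, cur_genNord]
  · rcases eq_or_ne i j with rfl | h
    · have hXY : charge i (.inl (.X i)) * m * pairing (.inl (.X i)) (.inl (.Y i)) = -m := by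
        simp [charge, pairing, dual, dualSign]
      have hpc : charge i (.inr (.psi i)) * m * pairing (.inr (.psi i)) (.inr (.chi i)) = m := by
        simp [charge, pairing, dual, dualSign]
      rw [hXY, hpc]
      split_ifs <;> module
    · simp [charge, h]
  all_goals by_cases h : i = j <;> simp [charge, h]

/-! ### The matter fields -/

/-- The bosons `X i` (for `true`) and `Y i` (for `false`). -/
def boson : Bool → Fin n → Gen n
  | true, i => .inl (.X i)
  | false, i => .inl (.Y i)

/-- The fermions `chi i` (for `true`) and `psi i` (for `false`), which have the same charges as the
bosons `X i` and `Y i`. -/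
def fermion : Bool → Fin n → Gen n
  | true, i => .inr (.chi i)
  | false, i => .inr (.psi i)

/-- The common charge of `X i` and `chi i` (for `true`), and of `Y i` and `psi i` (for `false`). -/
def sideCharge : Bool → ℂ
  | true => -1
  | false => 1

theorem sideCharge_not (σ : Bool) : sideCharge (!σ) = -sideCharge σ := by
  cases σ <;> simp [sideCharge]

theorem sideCharge_ne_zero (σ : Bool) : sideCharge σ ≠ 0 := by
  cases σ <;> simp [sideCharge]

theorem charge_boson (σ : Bool) (i j : Fin n) :
    charge i (boson σ j) = if i = j then sideCharge σ else 0 := by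
  cases σ <;> rfl

theorem charge_fermion (σ : Bool) (i j : Fin n) :
    charge i (fermion σ j) = if i = j then sideCharge σ else 0 := by
  cases σ <;> rfl

theorem charge_boson_self (σ : Bool) (j : Fin n) : charge j (boson σ j) = sideCharge σ := by
  rw [charge_boson, if_pos rfl]

theorem charge_fermion_self (σ : Bool) (j : Fin n) : charge j (fermion σ j) = sideCharge σ := by
  rw [charge_fermion, if_pos rfl]

/-- The field of `M_i^+ = X i psi i` (for `true`) or `M_i^- = Y i chi i` (for `false`). -/
def matter (σ : Bool) (i : Fin n) : fields ℂ (Fock n) := genNord (boson σ i) (fermion (!σ) i)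

theorem cur_matter (σ : Bool) (i j : Fin n) (m k : ℤ) (v : Fock n) :
    cur i m (matter σ j k v) = matter σ j k (cur i m v) := by
  have hp : pairing (boson σ j) (fermion (!σ) j) = 0 := by
    cases σ <;> simp [pairing, boson, fermion, dual]
  rw [matter, cur_genNord, hp]
  · simp
  · simp only [charge_boson, charge_fermion, sideCharge_not]
    split_ifs <;> simp

theorem genMode_c_cur (a : Fin (n - 1)) (i : Fin n) (p k : ℤ) (v : Fock n) :
    genMode (.inr (.c a)) p (cur i k v) = cur i k (genMode (.inr (.c a)) p v) := by
  simp [cur_genMode, charge]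

theorem genMode_c_matter (a : Fin (n - 1)) (σ : Bool) (i : Fin n) (p k : ℤ) (v : Fock n) :
    genMode (.inr (.c a)) p (matter σ i k v) = -matter σ i k (genMode (.inr (.c a)) p v) := by
  rw [matter, genMode_genNord]
  cases σ <;> simp [exchangeSign, pairing, dual, boson, fermion]

/-! ### The BRST charge -/

theorem exchange_c_current (a : Fin (n - 1)) (i : Fin n) :
    exchange (.inr (.c a)) (current i) = (1 : ℂ) • current i := by
  have hv : exchange (.inr (.c a)) vac = (1 : ℂ) • vac := by rw [exchange_vac, one_smul]
  have hXY := exchange_genMode (h := .inl (.X i)) (exchange_genMode (h := .inl (.Y i)) hv)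
  have hpc := exchange_genMode (h := .inr (.psi i)) (exchange_genMode (h := .inr (.chi i)) hv)
  have hsignXY : exchangeSign (.inr (.c a) : Gen n) (.inl (.X i) : Gen n) *
      (exchangeSign (.inr (.c a) : Gen n) (.inl (.Y i) : Gen n) * 1) = 1 := by simp [exchangeSign]
  have hsignpc : exchangeSign (.inr (.c a) : Gen n) (.inr (.psi i) : Gen n) *
      (exchangeSign (.inr (.c a) : Gen n) (.inr (.chi i) : Gen n) * 1) = 1 := by simp [exchangeSign]
  rw [← nop_gen, hsignXY] at hXY
  rw [← nop_gen, hsignpc] at hpc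
  rw [current, map_add, smul_add]
  exact congr($hXY + $hpc)

theorem stateField_nop_c_current (a : Fin (n - 1)) (i : Fin n) :
    stateField (nop (opC a) (current i)) = nord 1 (genField (.inr (.c a))) (cur i) := by
  rw [← stateField_current, ← stateField_genMode (exchange_c_current a i), ← nop_gen]
  rfl

/-- The BRST charge `Q` as a linear map. -/
def brst (n : ℕ) : Fock n →ₗ[ℂ] Fock n := (stateField (brstCurrent n)).1 0

theorem brst_apply (v : Fock n) : brst n v = Q v := (mode_eq _ _ _).symm

theorem nop_sub (u v w : Fock n) : nop u (v - w) = nop u v - nop u w := by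
  simp only [nop_eq, map_sub]

theorem brst_eq_sum (v : Fock n) : brst n v =
    ∑ a : Fin (n - 1),
      (nord 1 (genField (.inr (.c a))) (cur ⟨a.val, by have := a.isLt; omega⟩) 0 v -
        nord 1 (genField (.inr (.c a))) (cur ⟨a.val + 1, by have := a.isLt; omega⟩) 0 v) := by
  simp only [brst, brstCurrent, nop_sub, map_sum, map_sub, stateField_nop_c_current]
  rw [Submodule.coe_sum, Finset.sum_apply, LinearMap.sum_apply]
  rfl

/-- The states on which the nonnegative modes of the ghosts `c` vanish and those of all the
currents agree. A difference of two currents acts on them as a field without annihilation part. -/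
def invariants (n : ℕ) : Submodule ℂ (Fock n) where
  carrier := {v | (∀ (a : Fin (n - 1)) (m : ℕ), genMode (.inr (.c a)) m v = 0) ∧
    ∀ (i j : Fin n) (m : ℕ), cur i m v = cur j m v}
  zero_mem' := by simp
  add_mem' hv hw :=
    ⟨fun a m => by rw [map_add, hv.1, hw.1, add_zero],
      fun i j m => by rw [map_add, map_add, hv.2 i j, hw.2 i j]⟩
  smul_mem' z v hv :=
    ⟨fun a m => by rw [map_smul, hv.1, smul_zero],
      fun i j m => by rw [map_smul, map_smul, hv.2 i j]⟩

theorem cur_mem_invariants (i : Fin n) (k : ℤ) {v : Fock n} (hv : v ∈ invariants n) :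
    cur i k v ∈ invariants n :=
  ⟨fun a m => by rw [genMode_c_cur, hv.1, map_zero],
    fun j l m => by rw [cur_cur, cur_cur l, hv.2 j l]⟩

theorem matter_mem_invariants (σ : Bool) (i : Fin n) (k : ℤ) {v : Fock n}
    (hv : v ∈ invariants n) : matter σ i k v ∈ invariants n :=
  ⟨fun a m => by rw [genMode_c_matter, hv.1, map_zero, neg_zero],
    fun j l m => by rw [cur_matter, cur_matter, hv.2 j l]⟩

theorem nord_c_cur_eq (d : Fin (n - 1)) (i j : Fin n) {v : Fock n} (hv : v ∈ invariants n) :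
    nord 1 (genField (.inr (.c d))) (cur i) 0 v = nord 1 (genField (.inr (.c d))) (cur j) 0 v := by
  simp only [nord_apply, creMul_apply, annMul_apply, genField_apply, zero_add, hv.1, hv.2 i j,
    map_zero]

theorem genMode_b_nord_c_cur (a d : Fin (n - 1)) (i : Fin n) (v : Fock n) :
    genMode (.inr (.b a)) (-1) (nord 1 (genField (.inr (.c d))) (cur i) 0 v) =
      -nord 1 (genField (.inr (.c d))) (cur i) 0 (genMode (.inr (.b a)) (-1) v) +
        (if d = a then (1 : ℂ) else 0) • cur i (-1) v := by
  have hcur : HasSimpleOPE (1 : ℂ) 0 (genField (.inr (.b a))) (cur i) := fun k l v => by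
    simp [genField_apply, cur_genMode, charge]
  have h := (genField_hasSimpleOPE (.inr (.b a)) (.inr (.c d))).apply_nord (ε := 1)
    (exchangeSign_mul_self _ _) hcur (by simp) (by simp) (-1) 0 v
  simpa [exchangeSign, pairing, dual, dualSign, genField_apply, @eq_comm _ a] using h

theorem brst_genMode_b (a : Fin (n - 1)) {v : Fock n} (hv : v ∈ invariants n) :
    brst n (genMode (.inr (.b a)) (-1) v) =
      cur ⟨a.val, by have := a.isLt; omega⟩ (-1) v -
      cur ⟨a.val + 1, by have := a.isLt; omega⟩ (-1) v := by
  have hab (d : Fin (n - 1)) (i j : Fin n) :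
      nord 1 (genField (.inr (.c d))) (cur i) 0 (genMode (.inr (.b a)) (-1) v) -
        nord 1 (genField (.inr (.c d))) (cur j) 0 (genMode (.inr (.b a)) (-1) v) =
      (if d = a then (1 : ℂ) else 0) • (cur i (-1) v - cur j (-1) v) := by
    have h := congrArg (genMode (.inr (.b a)) (-1)) (nord_c_cur_eq d i j hv)
    rw [genMode_b_nord_c_cur, genMode_b_nord_c_cur] at h
    linear_combination (norm := module) -h
  rw [brst_eq_sum]
  simp only [hab]
  simp

theorem cur_sub_cur_mem_range (i j : Fin n) {v : Fock n} (hv : v ∈ invariants n) :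
    cur i (-1) v - cur j (-1) v ∈ LinearMap.range (brst n) := by
  have h0 : 0 < n := i.pos
  have key (m : ℕ) (hm : m < n) :
      cur ⟨0, h0⟩ (-1) v - cur ⟨m, hm⟩ (-1) v ∈ LinearMap.range (brst n) := by
    induction m with
    | zero => simp
    | succ m ih =>
      have hb : cur ⟨m, by omega⟩ (-1) v - cur ⟨m + 1, hm⟩ (-1) v ∈ LinearMap.range (brst n) :=
        ⟨_, brst_genMode_b ⟨m, by omega⟩ hv⟩
      simpa using add_mem (ih (by omega)) hb
  simpa using sub_mem (key j j.isLt) (key i i.isLt)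

/-- The span of the differences of two currents applied to invariant states. It consists of exact
states and, unlike the range of `Q`, is easily seen to be stable under the modes used below. -/
def currentExact (n : ℕ) : Submodule ℂ (Fock n) :=
  Submodule.span ℂ {w | ∃ i j, ∃ v ∈ invariants n, w = cur i (-1) v - cur j (-1) v}

theorem currentExact_le_range : currentExact n ≤ LinearMap.range (brst n) := by
  refine Submodule.span_le.2 ?_
  rintro _ ⟨i, j, v, hv, rfl⟩
  exact cur_sub_cur_mem_range i j hv

theorem equivalent_of_sub_mem {v w : Fock n} (h : v - w ∈ currentExact n) : Equivalent v w := by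
  obtain ⟨u, hu⟩ := currentExact_le_range h
  exact ⟨u, by rw [← brst_apply, hu]⟩

theorem map_mem_currentExact {f : Fock n →ₗ[ℂ] Fock n}
    (hinv : ∀ v ∈ invariants n, f v ∈ invariants n)
    (hcomm : ∀ i v, f (cur i (-1) v) = cur i (-1) (f v))
    {w : Fock n} (hw : w ∈ currentExact n) : f w ∈ currentExact n := by
  suffices h : currentExact n ≤ (currentExact n).comap f from h hw
  refine Submodule.span_le.2 ?_
  rintro _ ⟨i, j, v, hv, rfl⟩
  exact Submodule.subset_span ⟨i, j, f v, hinv v hv, by rw [map_sub, hcomm, hcomm]⟩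

theorem cur_mem_currentExact (i : Fin n) (k : ℤ) {v : Fock n} (hv : v ∈ currentExact n) :
    cur i k v ∈ currentExact n :=
  map_mem_currentExact (fun _ => cur_mem_invariants i k) (fun j _ => cur_cur i j _ _ _) hv

theorem matter_mem_currentExact (σ : Bool) (i : Fin n) (k : ℤ) {v : Fock n}
    (hv : v ∈ currentExact n) : matter σ i k v ∈ currentExact n :=
  map_mem_currentExact (fun _ => matter_mem_invariants σ i k)
    (fun j v => (cur_matter σ j i _ _ v).symm) hv

/-! ### Covariant derivatives -/

/-- The covariant derivative `D_i` as a linear map, with its terms collected. -/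
def covDLin (i : Fin n) : Fock n →ₗ[ℂ] Fock n :=
  genMode (.inl (.X i)) (-1) ∘ₗ genMode (.inl (.Y i)) (-1) -
    (2 : ℂ) • genNord (.inl (.X i)) (.inl (.Y i)) (-1)

theorem covDLin_apply (i : Fin n) (v : Fock n) : covDLin i v =
    genMode (.inl (.X i)) (-1) (genMode (.inl (.Y i)) (-1) v) -
      (2 : ℂ) • genNord (.inl (.X i)) (.inl (.Y i)) (-1) v := rfl

theorem covDLin_eq_covD (i : Fin n) (v : Fock n) : covDLin i v = covD i v := by
  have hXY : nop (opX i) (nop (opY i) v) =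
      genMode (.inl (.X i)) (-1) (genMode (.inl (.Y i)) (-1) v) :=
    (nop_gen (.inl (.X i)) _).trans (congrArg _ (nop_gen (.inl (.Y i)) v))
  have hA : nop (calA i) v = -genNord (.inl (.X i)) (.inl (.Y i)) (-1) v := by
    rw [nop_eq, calA, map_neg]
    exact congr(-$(stateField_nop_gen (.inl (.X i)) (.inl (.Y i))) (-1) v)
  rw [covDLin_apply, covD, partialD, hXY, hA]
  module

theorem genMode_covDLin {g : Gen n} {j : Fin n} (h : charge j g = 0) (p : ℤ) (v : Fock n) :
    genMode g p (covDLin j v) = covDLin j (genMode g p v) := by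
  have hX : pairing g (.inl (.X j)) = 0 :=
    pairing_eq_zero_of_charge (i := j) (by rw [h]; simp [charge])
  have hY : pairing g (.inl (.Y j)) = 0 :=
    pairing_eq_zero_of_charge (i := j) (by rw [h]; simp [charge])
  have hgX := genField_hasSimpleOPE g (.inl (.X j)) p (-1)
  have hgY := genField_hasSimpleOPE g (.inl (.Y j)) p (-1)
  simp only [genField_apply, hX, hY, ite_self, zero_smul, add_zero] at hgX hgY
  rw [covDLin_apply, covDLin_apply, map_sub, map_smul, genMode_genNord, hgX, hgY, hX, hY]
  simp [exchangeSign]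

theorem covDLin_comm (i j : Fin n) (v : Fock n) :
    covDLin i (covDLin j v) = covDLin j (covDLin i v) := by
  rcases eq_or_ne i j with rfl | hij
  · rfl
  have hgen (g : Gen n) (hg : charge i g = 0) (k : ℤ) (v : Fock n) :
      covDLin i (genField g k v) = (1 : ℂ) • genField g k (covDLin i v) := by
    rw [genField_apply, genMode_covDLin hg, one_smul]
  have hX := hgen (.inl (.X j)) (if_neg hij)
  have hY := hgen (.inl (.Y j)) (if_neg hij)
  have hXY := map_nord_of_comm (ε := 1) (one_mul 1) hX hY (-1)
  simp only [genField_apply, one_smul, mul_one] at hX hY hXY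
  rw [covDLin_apply j, map_sub, map_smul, hX, hY, covDLin_apply j, genNord]
  exact congr(_ - (2 : ℂ) • $(hXY v))

instance covD_leftCommutative : LeftCommutative (covD (n := n)) :=
  ⟨fun i j v => by simpa only [covDLin_eq_covD] using covDLin_comm i j v⟩

theorem covDProd_eq_covD {J : Finset (Fin n)} {j : Fin n} (hj : j ∈ J) (v : Fock n) :
    covDProd J v = covD j (covDProd (J \ {j}) v) := by
  have hperm : (J.sort (· ≤ ·)).Perm (j :: (J \ {j}).sort (· ≤ ·)) := by
    rw [List.perm_ext_iff_of_nodup (Finset.sort_nodup _ _) (by simp [Finset.sort_nodup])]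
    intro a
    by_cases h : a = j <;> simp [h, hj]
  exact hperm.foldr_eq v

theorem genMode_covDProd {g : Gen n} {J : Finset (Fin n)} (h : ∀ k ∈ J, charge k g = 0) (p : ℤ)
    (v : Fock n) : genMode g p (covDProd J v) = covDProd J (genMode g p v) := by
  refine List.foldr_rel (r := fun u w => genMode g p u = w) rfl ?_
  rintro k hk u _ rfl
  rw [← covDLin_eq_covD, ← covDLin_eq_covD, genMode_covDLin (h k ((Finset.mem_sort _).1 hk))]

theorem covDProd_smul (J : Finset (Fin n)) (z : ℂ) (v : Fock n) :
    covDProd J (z • v) = z • covDProd J v :=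
  List.foldr_hom (z • ·) fun k v => by rw [← covDLin_eq_covD, ← covDLin_eq_covD, map_smul]

theorem covDProd_zero (J : Finset (Fin n)) : covDProd J (0 : Fock n) = 0 := by
  simpa using covDProd_smul J 0 (0 : Fock n)

/-! ### The operators `hatX` and `hatY` -/

/-- The iterated normally ordered product of a word of generators, nested to the right. -/
def genWord (l : List (Gen n)) : Fock n := l.foldr (fun g => genMode g (-1)) vac

theorem genMode_natCast_genWord {g : Gen n} {l : List (Gen n)} (h : ∀ r ∈ l, pairing g r = 0)
    (m : ℕ) : genMode g m (genWord l) = 0 := by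
  induction l with
  | nil => exact genMode_vac g m
  | cons r l ih =>
    rw [List.forall_mem_cons] at h
    have hgr := genField_hasSimpleOPE g r m (-1) (genWord l)
    simp only [genField_apply, ih h.2, map_zero, h.1, ite_self, smul_zero, zero_smul,
      add_zero] at hgr
    exact hgr

theorem genMode_neg_one_comm (g h : Gen n) (v : Fock n) :
    genMode g (-1) (genMode h (-1) v) = exchangeSign g h • genMode h (-1) (genMode g (-1) v) :=
  (genField_hasSimpleOPE g h).apply_comm (by norm_num) v

theorem genWord_append_cons (l₁ l₂ : List (Gen n)) (g : Gen n) : genWord (l₁ ++ g :: l₂) =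
    (l₁.map (exchangeSign g)).prod • genMode g (-1) (genWord (l₁ ++ l₂)) := by
  induction l₁ with
  | nil => simp [genWord]
  | cons h l₁ ih =>
    have hcons (l : List (Gen n)) : genWord (h :: l) = genMode h (-1) (genWord l) := rfl
    rw [List.cons_append, hcons, ih, List.cons_append, hcons, map_smul, genMode_neg_one_comm h,
      List.map_cons, List.prod_cons, smul_smul, mul_comm, exchangeSign_comm]

/-- The `i`-th factor of `hatX I` (for `true`) or `hatY I` (for `false`). -/
def factor (σ : Bool) (I : Finset (Fin n)) (i : Fin n) : Gen n :=
  if i ∈ I then fermion σ i else boson σ i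

theorem charge_factor (σ : Bool) (I : Finset (Fin n)) (i j : Fin n) :
    charge j (factor σ I i) = if j = i then sideCharge σ else 0 := by
  unfold factor
  split_ifs <;> simp_all [charge_fermion, charge_boson]

/-- The common form of `hatX I` (for `true`) and `hatY I` (for `false`). -/
def hat (σ : Bool) (I : Finset (Fin n)) : Fock n := genWord ((List.finRange n).map (factor σ I))

theorem hat_eq_nestedProd (σ : Bool) (I : Finset (Fin n)) :
    hat σ I = nestedProd fun i => genMode (factor σ I i) (-1) vac := by
  simp only [hat, genWord, nestedProd, nop_gen, List.foldr_map]

theorem hat_true (I : Finset (Fin n)) : hat true I = hatX I := by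
  rw [hat_eq_nestedProd]
  exact congrArg nestedProd (funext fun i => apply_ite (fun g => genMode g (-1) vac) ..)

theorem hat_false (I : Finset (Fin n)) : hat false I = hatY I := by
  rw [hat_eq_nestedProd]
  exact congrArg nestedProd (funext fun i => apply_ite (fun g => genMode g (-1) vac) ..)

/-- The product `hat σ I` without its `j`-th factor. -/
def hatErase (σ : Bool) (I : Finset (Fin n)) (j : Fin n) : Fock n :=
  genWord (((List.finRange n).erase j).map (factor σ I))

theorem exists_finRange_eq (j : Fin n) : ∃ l₁ l₂ : List (Fin n),
    List.finRange n = l₁ ++ j :: l₂ ∧ (List.finRange n).erase j = l₁ ++ l₂ ∧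
      l₁.Nodup ∧ l₁.toFinset = Finset.Iio j := by
  obtain ⟨l₁, l₂, h⟩ := List.append_of_mem (List.mem_finRange j)
  have hlt := List.pairwise_lt_finRange n
  rw [h, List.pairwise_append, List.pairwise_cons] at hlt
  obtain ⟨h₁, ⟨h₂, -⟩, h₁₂⟩ := hlt
  have hmem (k : Fin n) : k ∈ l₁ ↔ k < j := by
    refine ⟨fun hk => h₁₂ k hk j (by simp), fun hk => ?_⟩
    have := h ▸ List.mem_finRange k
    rcases List.mem_append.1 this with hk' | hk'
    · exact hk'
    · rcases List.mem_cons.1 hk' with rfl | hk'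
      · exact absurd hk (lt_irrefl _)
      · exact absurd hk (h₂ k hk').asymm
  refine ⟨l₁, l₂, h, ?_, h₁.imp ne_of_lt, by ext k; simp [hmem]⟩
  rw [h, List.erase_append_right _ (by simp [hmem]), List.erase_cons_head]

theorem hat_eq_smul_genMode_hatErase (σ : Bool) (I : Finset (Fin n)) (j : Fin n) : hat σ I =
    (∏ k ∈ Finset.Iio j, exchangeSign (factor σ I j) (factor σ I k)) •
      genMode (factor σ I j) (-1) (hatErase σ I j) := by
  obtain ⟨l₁, l₂, h, herase, hnodup, hl₁⟩ := exists_finRange_eq j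
  rw [hat, h, List.map_append, List.map_cons, genWord_append_cons, ← List.map_append, hatErase,
    herase, List.map_map, ← hl₁, List.prod_toFinset _ hnodup]
  rfl

theorem hat_of_notMem (σ : Bool) {I : Finset (Fin n)} {j : Fin n} (hj : j ∉ I) :
    hat σ I = genMode (boson σ j) (-1) (hatErase σ I j) := by
  have hb : factor σ I j = boson σ j := if_neg hj
  have hsign (g : Gen n) : exchangeSign (boson σ j) g = 1 := by
    cases σ <;> simp [boson, exchangeSign]
  rw [hat_eq_smul_genMode_hatErase σ I j, hb]
  simp [hsign]

theorem hatErase_union_singleton (σ : Bool) (I : Finset (Fin n)) (j : Fin n) :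
    hatErase σ (I ∪ {j}) j = hatErase σ I j := by
  refine congrArg genWord (List.map_congr_left fun i hi => ?_)
  have hij : i ≠ j := ((List.nodup_finRange n).mem_erase_iff.1 hi).1
  simp [factor, hij]

theorem hat_union_singleton (σ : Bool) (I : Finset (Fin n)) (j : Fin n) :
    hat σ (I ∪ {j}) =
      (-1 : ℂ) ^ fermionCount I j • genMode (fermion σ j) (-1) (hatErase σ I j) := by
  have hf : factor σ (I ∪ {j}) j = fermion σ j := if_pos (by simp)
  have hsign (k : Fin n) (hk : k ∈ Finset.Iio j) :
      exchangeSign (fermion σ j) (factor σ (I ∪ {j}) k) = if k ∈ I then (-1 : ℂ) else 1 := by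
    have hkj : k ≠ j := (Finset.mem_Iio.1 hk).ne
    by_cases h : k ∈ I <;> cases σ <;> simp [factor, fermion, boson, exchangeSign, h, hkj]
  have hcard : (Finset.Iio j).filter (· ∈ I) = I.filter (· < j) := by
    ext k
    simp [and_comm]
  rw [hat_eq_smul_genMode_hatErase σ (I ∪ {j}) j, hf, hatErase_union_singleton,
    Finset.prod_congr rfl hsign, Finset.prod_ite, Finset.prod_const, Finset.prod_const_one,
    mul_one, hcard, fermionCount]

/-- The vector `v` is annihilated by the nonnegative modes of the generators that carry a charge
under the `j`-th current. -/
def AnnihilatedAt (j : Fin n) (v : Fock n) : Prop :=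
  ∀ g, charge j g ≠ 0 → ∀ m : ℕ, genMode g m v = 0

theorem annihilatedAt_hatErase (σ : Bool) (I : Finset (Fin n)) (j : Fin n) :
    AnnihilatedAt j (hatErase σ I j) := by
  refine fun g hg m => genMode_natCast_genWord (fun r hr => ?_) m
  obtain ⟨i, hi, rfl⟩ := List.mem_map.1 hr
  have hij : i ≠ j := ((List.nodup_finRange n).mem_erase_iff.1 hi).1
  exact pairing_eq_zero_of_charge (i := j) (by simpa [charge_factor, hij.symm] using hg)

theorem charge_eq_zero_of_ne {i j : Fin n} (hij : i ≠ j) {g : Gen n} (hg : charge j g ≠ 0) :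
    charge i g = 0 := by
  rcases g with (k | k) | (k | k | a | a) <;> simp only [charge] at hg ⊢ <;>
    simp_all

theorem AnnihilatedAt.covDProd {j : Fin n} {v : Fock n} (hv : AnnihilatedAt j v)
    {J : Finset (Fin n)} (hj : j ∉ J) : AnnihilatedAt j (covDProd J v) := fun g hg m => by
  have hJ (k : Fin n) (hk : k ∈ J) : charge k g = 0 :=
    charge_eq_zero_of_ne (ne_of_mem_of_not_mem hk hj) hg
  rw [genMode_covDProd hJ, hv g hg m, covDProd_zero]

/-- The common form of `hatX₂` and `hatY₂`. -/
def hat₂ (σ : Bool) (I J : Finset (Fin n)) : Fock n := covDProd J (hat σ I)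

theorem exists_hat₂_eq (σ : Bool) {I J : Finset (Fin n)} {j : Fin n} (hI : j ∉ I) (hJ : j ∉ J) :
    ∃ w, AnnihilatedAt j w ∧ hat₂ σ I J = genMode (boson σ j) (-1) w ∧
      hat₂ σ (I ∪ {j}) J = (-1 : ℂ) ^ fermionCount I j • genMode (fermion σ j) (-1) w := by
  have hne (k : Fin n) (hk : k ∈ J) : k ≠ j := ne_of_mem_of_not_mem hk hJ
  refine ⟨covDProd J (hatErase σ I j), (annihilatedAt_hatErase σ I j).covDProd hJ, ?_, ?_⟩
  · rw [hat₂, hat_of_notMem σ hI,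
      genMode_covDProd fun k hk => by rw [charge_boson, if_neg (hne k hk)]]
  · rw [hat₂, hat_union_singleton, covDProd_smul,
      genMode_covDProd fun k hk => by rw [charge_fermion, if_neg (hne k hk)]]

theorem genMode_c_natCast_hat₂ (a : Fin (n - 1)) (σ : Bool) (I J : Finset (Fin n)) (m : ℕ) :
    genMode (.inr (.c a)) m (hat₂ σ I J) = 0 := by
  have hc (r : Gen n) (hr : r ∈ (List.finRange n).map (factor σ I)) :
      pairing (.inr (.c a)) r = 0 := by
    obtain ⟨i, -, rfl⟩ := List.mem_map.1 hr
    have hca : charge i (.inr (.c a)) = 0 := rfl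
    refine pairing_eq_zero_of_charge (i := i) ?_
    rw [hca, charge_factor, if_pos rfl, zero_add]
    exact sideCharge_ne_zero σ
  rw [hat₂, genMode_covDProd fun _ _ => rfl, hat, genMode_natCast_genWord hc, covDProd_zero]

/-! ### Local computations -/

section AnnihilatedAt

variable {j : Fin n} {w : Fock n}

theorem AnnihilatedAt.genNord_natCast (hw : AnnihilatedAt j w) {g h : Gen n}
    (hg : charge j g ≠ 0) (hh : charge j h ≠ 0) (m : ℕ) : genNord g h m w = 0 :=
  nord_apply_natCast_eq_zero _ (hw g hg) (hw h hh) m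

theorem AnnihilatedAt.genNord_neg_one (hw : AnnihilatedAt j w) {g h : Gen n}
    (hg : charge j g ≠ 0) (hh : charge j h ≠ 0) :
    genNord g h (-1) w = genMode g (-1) (genMode h (-1) w) :=
  nord_apply_neg_one _ (hw g hg) (hw h hh)

theorem AnnihilatedAt.cur_natCast (hw : AnnihilatedAt j w) (m : ℕ) : cur j m w = 0 := by
  rw [cur_apply, hw.genNord_natCast (by simp [charge]) (by simp [charge]),
    hw.genNord_natCast (by simp [charge]) (by simp [charge]), add_zero]

theorem AnnihilatedAt.cur_natCast_genMode (hw : AnnihilatedAt j w) {g : Gen n}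
    (hg : charge j g ≠ 0) (m : ℕ) : cur j m (genMode g (-1) w) =
      if m = 0 then charge j g • genMode g (-1) w else 0 := by
  rw [cur_genMode, hw.cur_natCast, map_zero, zero_add]
  cases m with
  | zero => simp
  | succ m =>
    rw [show (-1 : ℤ) + (m + 1 : ℕ) = m by push_cast; ring, hw g hg, smul_zero,
      if_neg m.succ_ne_zero]

theorem AnnihilatedAt.matter_fermion (hw : AnnihilatedAt j w) (σ : Bool) :
    matter σ j (-1) (genMode (fermion σ j) (-1) w) = genMode (boson σ j) (-2) w -
      genMode (fermion σ j) (-1) (genMode (boson σ j) (-1) (genMode (fermion (!σ) j) (-1) w)) := by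
  have hb : charge j (boson σ j) ≠ 0 := charge_boson_self σ j ▸ sideCharge_ne_zero σ
  have hf : charge j (fermion (!σ) j) ≠ 0 := charge_fermion_self (!σ) j ▸ sideCharge_ne_zero _
  have h := genMode_genNord (fermion σ j) (boson σ j) (fermion (!σ) j) (-1) (-1) w
  rw [hw.genNord_neg_one hb hf] at h
  rw [h]
  cases σ <;> simp [matter, boson, fermion, exchangeSign, pairing, dual, dualSign]

theorem AnnihilatedAt.genMode_boson_genNord_psi_chi (hw : AnnihilatedAt j w) (σ : Bool) :
    genMode (boson σ j) (-1) (genNord (.inr (.psi j)) (.inr (.chi j)) (-1) w) =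
      sideCharge σ • genMode (fermion σ j) (-1)
        (genMode (boson σ j) (-1) (genMode (fermion (!σ) j) (-1) w)) := by
  rw [hw.genNord_neg_one (by simp [charge]) (by simp [charge]),
    genMode_neg_one_comm (fermion σ j) (boson σ j), ← map_smul, ← map_smul]
  cases σ
  · simp [boson, fermion, exchangeSign, sideCharge]
  · rw [genMode_neg_one_comm (.inr (.psi j))]
    simp [boson, fermion, exchangeSign, sideCharge]

theorem genNord_X_Y_boson (σ : Bool) (v : Fock n) :
    genNord (.inl (.X j)) (.inl (.Y j)) (-1) (genMode (boson σ j) (-1) v) =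
      genMode (boson σ j) (-1) (genNord (.inl (.X j)) (.inl (.Y j)) (-1) v) +
        sideCharge σ • genMode (boson σ j) (-2) v := by
  rw [genMode_genNord]
  cases σ <;> simp [boson, exchangeSign, pairing, dual, dualSign, sideCharge]

theorem AnnihilatedAt.covD_boson (hw : AnnihilatedAt j w) (σ : Bool) :
    covD j (genMode (boson σ j) (-1) w) = -cur j (-1) (genMode (boson σ j) (-1) w) -
      sideCharge σ • matter σ j (-1) (genMode (fermion σ j) (-1) w) := by
  have hXY : genMode (.inl (.X j)) (-1) (genMode (.inl (.Y j)) (-1) (genMode (boson σ j) (-1) w)) =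
      genMode (boson σ j) (-1) (genNord (.inl (.X j)) (.inl (.Y j)) (-1) w) := by
    have hsign (g : EvenGen n) : exchangeSign (.inl g : Gen n) (boson σ j) = 1 := by
      simp [exchangeSign]
    rw [hw.genNord_neg_one (by simp [charge]) (by simp [charge]),
      genMode_neg_one_comm (.inl (.Y j)), map_smul, genMode_neg_one_comm (.inl (.X j)),
      hsign, hsign, one_smul, one_smul]
  rw [← covDLin_eq_covD, covDLin_apply, hXY, genNord_X_Y_boson, cur_genMode, cur_apply, map_add,
    hw.genMode_boson_genNord_psi_chi, hw.matter_fermion, charge_boson_self,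
    show (-1 + -1 : ℤ) = -2 by norm_num]
  module

theorem AnnihilatedAt.cur_natCast_covD_boson (hw : AnnihilatedAt j w) (σ : Bool) (m : ℕ) :
    cur j m (covD j (genMode (boson σ j) (-1) w)) =
      if m = 0 then sideCharge σ • covD j (genMode (boson σ j) (-1) w) else 0 := by
  have hb := charge_boson_self σ j
  have hf := charge_fermion_self σ j
  have hs := sideCharge_ne_zero σ
  rw [hw.covD_boson, map_sub, map_neg, map_smul, cur_cur, cur_matter,
    hw.cur_natCast_genMode (hb ▸ hs), hw.cur_natCast_genMode (hf ▸ hs), hb, hf]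
  split_ifs
  · simp only [map_smul]
    module
  · simp only [map_zero, neg_zero, smul_zero, sub_zero]

end AnnihilatedAt

theorem hat₂_eq_covD (σ : Bool) (I : Finset (Fin n)) {J : Finset (Fin n)} {j : Fin n}
    (hj : j ∈ J) : hat₂ σ I J = covD j (hat₂ σ I (J \ {j})) := covDProd_eq_covD hj _

theorem cur_natCast_hat₂ (σ : Bool) {I J : Finset (Fin n)} (h : Disjoint I J) (i : Fin n) (m : ℕ) :
    cur i m (hat₂ σ I J) = if m = 0 then sideCharge σ • hat₂ σ I J else 0 := by
  have hb := charge_boson_self σ i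
  have hf := charge_fermion_self σ i
  have hs := sideCharge_ne_zero σ
  by_cases hJ : i ∈ J
  · have hI : i ∉ I := Finset.disjoint_right.1 h hJ
    obtain ⟨w, hw, hat_eq, -⟩ := exists_hat₂_eq σ (J := J \ {i}) hI (by simp)
    rw [hat₂_eq_covD σ I hJ, hat_eq, hw.cur_natCast_covD_boson]
  by_cases hI : i ∈ I
  · obtain ⟨w, hw, -, hat_eq⟩ := exists_hat₂_eq σ (I := I \ {i}) (j := i) (by simp) hJ
    rw [Finset.sdiff_union_of_subset (by simpa using hI)] at hat_eq
    rw [hat_eq, map_smul, hw.cur_natCast_genMode (hf ▸ hs), hf, smul_ite, smul_zero, smul_comm]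
  · obtain ⟨w, hw, hat_eq, -⟩ := exists_hat₂_eq σ hI hJ
    rw [hat_eq, hw.cur_natCast_genMode (hb ▸ hs), hb]

theorem hat₂_mem_invariants (σ : Bool) {I J : Finset (Fin n)} (h : Disjoint I J) :
    hat₂ σ I J ∈ invariants n :=
  ⟨fun a => genMode_c_natCast_hat₂ a σ I J,
    fun i j m => by rw [cur_natCast_hat₂ σ h, cur_natCast_hat₂ σ h]⟩

/-! ### The recursion -/

theorem nop_opU_add_opUF (v : Fock n) :
    nop (opU n + opUF n) v = -((1 / n : ℂ) • ∑ i : Fin n, cur i (-1) v) := by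
  have hU : opU n + opUF n = -((1 / n : ℂ) • ∑ i : Fin n, current i) := by
    simp only [opU, opUF, current, Finset.sum_add_distrib, smul_add, neg_add]
  rw [nop_eq, hU, map_neg, map_smul, map_sum]
  simp only [stateField_current]
  refine congr(-((1 / n : ℂ) • $(?_)))
  rw [Submodule.coe_sum, Finset.sum_apply, LinearMap.sum_apply]

theorem neg_cur_sub_nop_mem_currentExact (j : Fin n) {v : Fock n} (hv : v ∈ invariants n) :
    -cur j (-1) v - nop (opU n + opUF n) v ∈ currentExact n := by
  have hn : (n : ℂ) ≠ 0 := Nat.cast_ne_zero.2 j.pos.ne'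
  have haverage : -cur j (-1) v - nop (opU n + opUF n) v =
      (1 / n : ℂ) • ∑ i : Fin n, (cur i (-1) v - cur j (-1) v) := by
    rw [nop_opU_add_opUF, Finset.sum_sub_distrib, Finset.sum_const, Finset.card_univ,
      Fintype.card_fin, ← Nat.cast_smul_eq_nsmul ℂ, smul_sub, smul_smul, one_div_mul_cancel hn]
    module
  rw [haverage]
  exact Submodule.smul_mem _ _ (Submodule.sum_mem _ fun i _ =>
    Submodule.subset_span ⟨i, j, v, hv, rfl⟩)

theorem nop_opU_add_opUF_mem_currentExact {v : Fock n} (hv : v ∈ currentExact n) :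
    nop (opU n + opUF n) v ∈ currentExact n := by
  rw [nop_opU_add_opUF]
  exact neg_mem (Submodule.smul_mem _ _ (sum_mem fun i _ => cur_mem_currentExact i (-1) hv))

/-- The operator `M_i^+` (for `true`) or `M_i^-` (for `false`). -/
def opM (σ : Bool) (i : Fin n) : Fock n :=
  nop (genMode (boson σ i) (-1) vac) (genMode (fermion (!σ) i) (-1) vac)

theorem nop_opM (σ : Bool) (i : Fin n) (v : Fock n) : nop (opM σ i) v = matter σ i (-1) v := by
  rw [nop_eq, opM, stateField_nop_gen, matter]

/-- The coefficient of `M_j^±` in the recursion for `hatX₂ I J` (for `true`) and `hatY₂ I J`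
(for `false`). -/
def matterSign (σ : Bool) (I : Finset (Fin n)) (j : Fin n) : ℂ :=
  -sideCharge σ * (-1) ^ fermionCount I j

theorem covD_hat₂_sub_mem_currentExact (σ : Bool) {I J : Finset (Fin n)} {j : Fin n}
    (hIJ : Disjoint I J) (hI : j ∉ I) (hJ : j ∉ J) :
    covD j (hat₂ σ I J) - (nop (opU n + opUF n) (hat₂ σ I J) +
      matterSign σ I j • nop (opM σ j) (hat₂ σ (I ∪ {j}) J)) ∈ currentExact n := by
  have hcur := neg_cur_sub_nop_mem_currentExact j (hat₂_mem_invariants σ hIJ)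
  obtain ⟨w, hw, hat_eq, hat_union_eq⟩ := exists_hat₂_eq σ hI hJ
  have hsign : matterSign σ I j * (-1) ^ fermionCount I j = -sideCharge σ := by
    rw [matterSign, mul_assoc, ← mul_pow, neg_one_mul, neg_neg, one_pow, mul_one]
  rw [hat_eq] at hcur ⊢
  rw [hat_union_eq, nop_opM, map_smul, smul_smul, hsign, hw.covD_boson]
  convert hcur using 1
  module

theorem isNormallyOrderedPolynomial_opU_add_opUF :
    IsNormallyOrderedPolynomial (generators n) (opU n + opUF n) :=
  .add _ _ (.mem _ (.inl (.inl (.inl (.inl (.inl rfl))))))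
    (.mem _ (.inl (.inl (.inl (.inl (.inr rfl))))))

theorem opM_mem_generators (σ : Bool) (i : Fin n) : opM σ i ∈ generators n := by
  cases σ
  · exact .inl (.inl (.inr ⟨i, rfl⟩))
  · exact .inl (.inl (.inl (.inr ⟨i, rfl⟩)))

theorem hat_mem_generators (σ : Bool) (I : Finset (Fin n)) : hat σ I ∈ generators n := by
  cases σ
  · exact .inr ⟨I, (hat_false I).symm⟩
  · exact .inl (.inr ⟨I, (hat_true I).symm⟩)

theorem exists_polynomial_covD {σ : Bool} {I J : Finset (Fin n)} {j : Fin n}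
    (hIJ : Disjoint I J) (hI : j ∉ I) (hJ : j ∉ J)
    (h : ∃ P, IsNormallyOrderedPolynomial (generators n) P ∧ hat₂ σ I J - P ∈ currentExact n)
    (h' : ∃ P, IsNormallyOrderedPolynomial (generators n) P ∧
      hat₂ σ (I ∪ {j}) J - P ∈ currentExact n) :
    ∃ P, IsNormallyOrderedPolynomial (generators n) P ∧
      covD j (hat₂ σ I J) - P ∈ currentExact n := by
  obtain ⟨P, hP, hPexact⟩ := h
  obtain ⟨R, hR, hRexact⟩ := h'
  refine ⟨nop (opU n + opUF n) P + matterSign σ I j • nop (opM σ j) R,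
    .add _ _ (.nop _ _ isNormallyOrderedPolynomial_opU_add_opUF hP)
      (.smul _ _ (.nop _ _ (.mem _ (opM_mem_generators σ j)) hR)), ?_⟩
  have hrec := covD_hat₂_sub_mem_currentExact σ hIJ hI hJ
  have hU := nop_opU_add_opUF_mem_currentExact hPexact
  have hM := matter_mem_currentExact σ j (-1) hRexact
  rw [← nop_opM] at hM
  rw [nop_sub] at hU hM
  convert add_mem (add_mem hrec hU) (Submodule.smul_mem _ (matterSign σ I j) hM) using 1
  module

theorem exists_polynomial_hat₂ (σ : Bool) {I J : Finset (Fin n)} (hIJ : Disjoint I J) :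
    ∃ P, IsNormallyOrderedPolynomial (generators n) P ∧ hat₂ σ I J - P ∈ currentExact n := by
  induction J using Finset.induction_on generalizing I with
  | empty => exact ⟨hat σ I, .mem _ (hat_mem_generators σ I), by simp [hat₂, covDProd]⟩
  | insert j J hj ih =>
    obtain ⟨hjI, hIJ⟩ := Finset.disjoint_insert_right.1 hIJ
    have hcovD : hat₂ σ I (insert j J) = covD j (hat₂ σ I J) := by
      rw [hat₂_eq_covD σ I (Finset.mem_insert_self j J), Finset.sdiff_singleton_eq_erase,
        Finset.erase_insert hj]
    rw [hcovD]
    exact exists_polynomial_covD hIJ hjI hj (ih hIJ)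
      (ih (Finset.disjoint_union_left.2 ⟨hIJ, Finset.disjoint_singleton_left.2 hj⟩))

/-! ### The boundary operators -/

theorem hat₂_true (I J : Finset (Fin n)) : hat₂ true I J = hatX₂ I J := by
  rw [hat₂, hat_true, hatX₂]

theorem hat₂_false (I J : Finset (Fin n)) : hat₂ false I J = hatY₂ I J := by
  rw [hat₂, hat_false, hatY₂]

theorem hatX₂_empty (J : Finset (Fin n)) : hatX₂ ∅ J = calX J := by
  simp [hatX₂, hatX, calX]

theorem hatY₂_empty (J : Finset (Fin n)) : hatY₂ ∅ J = calY J := by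
  simp [hatY₂, hatY, calY]

theorem covD_hatX₂_equivalent {I J : Finset (Fin n)} {j : Fin n}
    (hIJ : Disjoint I J) (hI : j ∉ I) (hJ : j ∉ J) :
    Equivalent (covD j (hatX₂ I J)) (nop (opU n + opUF n) (hatX₂ I J) +
      ((-1 : ℂ) ^ fermionCount I j) • nop (opMplus j) (hatX₂ (I ∪ {j}) J)) := by
  have h := equivalent_of_sub_mem (covD_hat₂_sub_mem_currentExact true hIJ hI hJ)
  rw [hat₂_true, hat₂_true, matterSign, sideCharge, neg_neg, one_mul] at h
  exact h

theorem covD_hatY₂_equivalent {I J : Finset (Fin n)} {j : Fin n}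
    (hIJ : Disjoint I J) (hI : j ∉ I) (hJ : j ∉ J) :
    Equivalent (covD j (hatY₂ I J)) (nop (opU n + opUF n) (hatY₂ I J) -
      ((-1 : ℂ) ^ fermionCount I j) • nop (opMminus j) (hatY₂ (I ∪ {j}) J)) := by
  have h := equivalent_of_sub_mem (covD_hat₂_sub_mem_currentExact false hIJ hI hJ)
  rw [hat₂_false, hat₂_false, matterSign, sideCharge, neg_one_mul, neg_smul,
    ← sub_eq_add_neg] at h
  exact h

end BoundaryVOA

end

theorem mainTheorem9 (n : ℕ) (hn : 2 ≤ n) :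
    (∀ (I J : Finset (Fin n)) (j : Fin n), Disjoint I J → j ∈ J →
      (BoundaryVOA.hatX₂ I J = BoundaryVOA.covD j (BoundaryVOA.hatX₂ I (J \ {j})) ∧
        BoundaryVOA.Equivalent
          (BoundaryVOA.covD j (BoundaryVOA.hatX₂ I (J \ {j})))
          (BoundaryVOA.nop (BoundaryVOA.opU n + BoundaryVOA.opUF n)
              (BoundaryVOA.hatX₂ I (J \ {j})) +
            ((-1 : ℂ) ^ BoundaryVOA.fermionCount I j) •
              BoundaryVOA.nop (BoundaryVOA.opMplus j)
                (BoundaryVOA.hatX₂ (I ∪ {j}) (J \ {j})))) ∧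
      (BoundaryVOA.hatY₂ I J = BoundaryVOA.covD j (BoundaryVOA.hatY₂ I (J \ {j})) ∧
        BoundaryVOA.Equivalent
          (BoundaryVOA.covD j (BoundaryVOA.hatY₂ I (J \ {j})))
          (BoundaryVOA.nop (BoundaryVOA.opU n + BoundaryVOA.opUF n)
              (BoundaryVOA.hatY₂ I (J \ {j})) -
            ((-1 : ℂ) ^ BoundaryVOA.fermionCount I j) •
              BoundaryVOA.nop (BoundaryVOA.opMminus j)
                (BoundaryVOA.hatY₂ (I ∪ {j}) (J \ {j}))))) ∧
    (∀ I : Finset (Fin n),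
      (∃ P : BoundaryVOA.Fock n,
        BoundaryVOA.IsNormallyOrderedPolynomial (BoundaryVOA.generators n) P ∧
          BoundaryVOA.Equivalent (BoundaryVOA.calX I) P) ∧
      (∃ P : BoundaryVOA.Fock n,
        BoundaryVOA.IsNormallyOrderedPolynomial (BoundaryVOA.generators n) P ∧
          BoundaryVOA.Equivalent (BoundaryVOA.calY I) P)) := by
  refine ⟨fun I J j hIJ hj => ?_, fun I => ?_⟩
  · have hI : j ∉ I := Finset.disjoint_right.1 hIJ hj
    have hJ : j ∉ J \ {j} := by simp
    have hIJ' : Disjoint I (J \ {j}) := hIJ.mono_right Finset.sdiff_subset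
    exact ⟨⟨BoundaryVOA.covDProd_eq_covD hj _, BoundaryVOA.covD_hatX₂_equivalent hIJ' hI hJ⟩,
      ⟨BoundaryVOA.covDProd_eq_covD hj _, BoundaryVOA.covD_hatY₂_equivalent hIJ' hI hJ⟩⟩
  · obtain ⟨P, hP, hPX⟩ := BoundaryVOA.exists_polynomial_hat₂ true (Finset.disjoint_empty_left I)
    obtain ⟨R, hR, hRY⟩ := BoundaryVOA.exists_polynomial_hat₂ false (Finset.disjoint_empty_left I)
    rw [BoundaryVOA.hat₂_true, BoundaryVOA.hatX₂_empty] at hPX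
    rw [BoundaryVOA.hat₂_false, BoundaryVOA.hatY₂_empty] at hRY
    exact ⟨⟨P, hP, BoundaryVOA.equivalent_of_sub_mem hPX⟩,
      ⟨R, hR, BoundaryVOA.equivalent_of_sub_mem hRY⟩⟩
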